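/- Let $q>0$ be real and $n\ge 0$. A (noncrossing) half-diagram $\mathfrak a$ on $n$ points is a partition of $\{1,\dots,n\}$ into pairs ("arches") and singletons ("through-strings") such that there are no $i<k<j<l$ with $i$ paired to $j$ and $k$ paired to $l$, and no $i<k<j$ with $i$ paired to $j$ and $k$ a through-string. Let $U(n)$ be the complex vector space with basis $\xi_{\mathfrak a}$, $\mathfrak a$ running over these half-diagrams, and let $\langle\cdot,\cdot\rangle$ be the sesquilinear form on $U(n)$ for which $\langle\xi_{\mathfrak a},\xi_{\mathfrak b}\rangle$ is $0$ if gluing $\mathfrak a$ and $\mathfrak b$ along their points joins two through-strings of $\mathfrak a$, or two of $\mathfrak b$, and is $q^{c}$ otherwise, $c$ being the number of closed loops that arise. For $1\le i\le n-1$ let $e_i$ be the Temperley–Lieb diagram on points $1,\dots,2n$ that pairs $i$ with $i+1$, $2n-i$ with $2n-i+1$, and every other $j$ with $2n-j+1$; it acts linearly on $U(n)$ by concatenation, identifying its point $2n-j+1$ with the $j$th point of a half-diagram: $e_i\xi_{\mathfrak a}=0$ if two through-strings of $\mathfrak a$ become joined, and otherwise $e_i\xi_{\mathfrak a}=q^{c}\xi_{\mathfrak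 b}$, where $\mathfrak b$ is the resulting half-diagram on the points $1,\dots,n$ and $c$ is the number of closed loops. The bracket of $\mathfrak a$ at a point is closing if the point is paired with an earlier one, and opening otherwise; $h_i(\mathfrak a)$, $0\le i\le n$, is the number of opening minus the number of closing brackets among the first $i$. Half-diagrams correspond in this way bijectively to lattice paths $(i,h_i)_{0\le i\le n}$ with $h_0=0$, $h_{i}-h_{i-1}=\pm1$ and $h_i\ge 0$. For $1\le i\le n-1$, $\mathfrak a$ has a maximum at $i$ if $h_i>h_{i-1}$ and $h_i>h_{i+1}$, and a minimum at $i$ if $h_i<h_{i-1}$ and $h_i<h_{i+1}$. If $\mathfrak a$ has a minimum at such an $i$, $\Diamond_i(\mathfrak a)$ is the half-diagram whose path is that of $\mathfrak a$ with the $i$th step made upward and the $(i+1)$th step made downward. Let $\Delta_m(q)$ be the determinant of the $m\times m$ matrix with diagonal entries $q$, sub- and superdiagonal entries $1$ and all other entries $0$ (so $\Delta_0=1$, $\Delta_1=q$, $\Delta_{m+1}=q\Delta_m-\Delta_{m-1}$), and put $\mu_m=\Delta_{m-1}(q)/\Delta_m(q)$. The vectors $\xi'_{\mathfrak a}$ are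 defined by $\xi'_{\mathfrak a}=\xi_{\mathfrak a}$ if the height just before every closing bracket of $\mathfrak a$ is $1$, and $\xi'_{\Diamond_i(\mathfrak a)}=\bigl(e_i-\mu_{h_i(\mathfrak a)+1}\bigr)\xi'_{\mathfrak a}$ whenever $\mathfrak a$ has a minimum at $i$, $1\le i\le n-1$; every half-diagram is reached by such box additions, and the result does not depend on their order. **Corollary.** Let $\mathfrak a$ be a half-diagram on $n$ points with maxima at exactly $i_1,\dots,i_r$ and minima at exactly $j_1,\dots,j_s$, where in addition $n$ is counted among the minima if the last step of $\mathfrak a$ is decreasing (but $n$ is not counted as a maximum if the last step is increasing). Assume that $\Delta_k(q)\ne 0$ for every $k$ that is smaller than the height of some maximum of $\mathfrak a$ (so that all the quotients $\mu_m$ that define $\xi'_{\mathfrak a}$ make sense). Then $$\langle\xi'_{\mathfrak a},\xi'_{\mathfrak a}\rangle=\frac{\Delta_{h_{i_1}(\mathfrak a)}(q)\cdots\Delta_{h_{i_r}(\mathfrak a)}(q)}{\Delta_{h_{j_1}(\mathfrak a)}(q)\cdots\Delta_{h_{j_s}(\mathfrak a)}(q)}.$$ -/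

import Mathlib

namespace TemperleyLieb

/-- A noncrossing half-diagram on `n` points.  The `i`th point (counted from `1`) is the element
`i - 1` of `Fin n`.  `partner` sends each paired point to the point it is paired with, and fixes
each point that carries a through-string. -/
@[ext]
structure HalfDiagram (n : ℕ) where
  partner : Fin n → Fin n
  partner_partner : ∀ i, partner (partner i) = i
  no_crossing : ∀ i j k l, i < k → k < j → j < l → partner i = j → partner k ≠ l
  no_through_crossing : ∀ i j k, i < k → k < j → partner i = j → partner k ≠ k

/-- A noncrossing pairing of `2 * n` points: a noncrossing half-diagram on `2 * n` points
without through-strings.  These index the diagram basis of the Temperley-Lieb algebra `TL_n`. -/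
structure Diagram (n : ℕ) extends HalfDiagram (2 * n) where
  partner_ne : ∀ i, partner i ≠ i

noncomputable instance (n : ℕ) : Fintype (HalfDiagram n) :=
  Fintype.ofInjective HalfDiagram.partner fun _ _ h => HalfDiagram.ext h

/-- The space `U(n)` of formal complex linear combinations of half-diagrams on `n` points. -/
abbrev U (n : ℕ) : Type := HalfDiagram n →₀ ℂ

/-- The basis vector `ξ_a`. -/
noncomputable def xi {n : ℕ} (a : HalfDiagram n) : U n := Finsupp.single a 1

/-! ### The action of diagrams on half-diagrams -/

/-- The `i`th point of a full diagram, `1 ≤ i ≤ n` (on its left side). -/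
def left {n : ℕ} (i : Fin n) : Fin (2 * n) := ⟨i.val, by omega⟩

/-- The `(2n - i + 1)`th point of a full diagram, `1 ≤ i ≤ n` (on its right side): the point
that is identified with the `i`th point of a half-diagram. -/
def right {n : ℕ} (i : Fin n) : Fin (2 * n) := ⟨2 * n - 1 - i.val, by omega⟩

/-- The concatenation of the diagram `p` with the half-diagram `a`: the points are those of `p`,
the edges are those of `p` and those of `a`, the `i`th point of `a` being `right i`. -/
def concat {n : ℕ} (p : Diagram n) (a : HalfDiagram n) : SimpleGraph (Fin (2 * n)) :=
  SimpleGraph.fromRel fun x y =>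
    p.partner x = y ∨ ∃ i, x = right i ∧ y = right (a.partner i)

/-- Two different through-strings of `a` are joined in the concatenation of `p` with `a`. -/
def ThroughJoined {n : ℕ} (p : Diagram n) (a : HalfDiagram n) : Prop :=
  ∃ i j, i ≠ j ∧ a.partner i = i ∧ a.partner j = j ∧ (concat p a).Reachable (right i) (right j)

/-- The number of closed loops in the concatenation: the number of components that contain
neither a point on the left of `p` nor a through-string of `a`. -/
noncomputable def concatLoops {n : ℕ} (p : Diagram n) (a : HalfDiagram n) : ℕ :=
  Set.ncard {c : (concat p a).ConnectedComponent |
    ∀ i : Fin n, left i ∉ c.supp ∧ (a.partner i = i → right i ∉ c.supp)}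

/-- `b` is what remains of the concatenation of `p` with `a` on the left points of `p`: two
different points are paired in `b` if and only if they are joined in the concatenation. -/
def IsConcat {n : ℕ} (p : Diagram n) (a b : HalfDiagram n) : Prop :=
  ∀ i j, i ≠ j → (b.partner i = j ↔ (concat p a).Reachable (left i) (left j))

open Classical in
/-- The coefficient of `ξ_b` in `e_p ξ_a`: `e_p ξ_a = 0` if two through-strings of `a` are joined,
and otherwise `e_p ξ_a = q ^ c ξ_b` with `b` the resulting half-diagram and `c` the number of
closed loops. -/
noncomputable def actCoeff (q : ℝ) {n : ℕ} (p : Diagram n) (a b : HalfDiagram n) : ℂ :=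
  if ¬ ThroughJoined p a ∧ IsConcat p a b then (q : ℂ) ^ concatLoops p a else 0

/-- The action of the basis element `e_p` of `TL_n(q)` on `U(n)`. -/
noncomputable def act (q : ℝ) {n : ℕ} (p : Diagram n) : U n →ₗ[ℂ] U n :=
  Finsupp.linearCombination ℂ fun a => ∑ b, actCoeff q p a b • xi b

/-- The partner function of `e_i`: it pairs the points `i, i + 1`, the points
`2n - i + 1, 2n - i`, and otherwise `j` with `2n - j + 1`. -/
def genPartner (n i x : ℕ) : ℕ :=
  if x + 1 = i then i
  else if x = i then i - 1
  else if x + i = 2 * n then 2 * n - i - 1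
  else if x + i + 1 = 2 * n then 2 * n - i
  else 2 * n - 1 - x

/-- The diagram `e_i`, `1 ≤ i ≤ n - 1`. -/
def gen (n i : ℕ) (h₀ : 0 < i) (h₁ : i < n) : Diagram n where
  partner x := ⟨genPartner n i x.val, by
    have := x.isLt
    unfold genPartner
    split_ifs <;> omega⟩
  partner_partner x := by
    have := x.isLt
    apply Fin.ext
    simp only [genPartner]
    split_ifs <;> omega
  no_crossing i j k l hik hkj hjl hi hk := by
    have := l.isLt
    simp only [Fin.ext_iff, Fin.lt_def, genPartner] at *
    split_ifs at hi hk <;> omega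
  no_through_crossing i j k hik hkj hi hk := by
    have := j.isLt
    simp only [Fin.ext_iff, Fin.lt_def, genPartner] at *
    split_ifs at hi hk <;> omega
  partner_ne x hx := by
    have := x.isLt
    simp only [Fin.ext_iff, genPartner] at *
    split_ifs at hx <;> omega

/-! ### The sesquilinear form -/

/-- The half-diagrams `a` and `b` glued along their points. -/
def glue {n : ℕ} (a b : HalfDiagram n) : SimpleGraph (Fin n) :=
  SimpleGraph.fromRel fun x y => a.partner x = y ∨ b.partner x = y

/-- Two different through-strings on the same side are joined in the glued diagram. -/
def SameSideJoined {n : ℕ} (a b : HalfDiagram n) : Prop :=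
  ∃ i j, i ≠ j ∧ (glue a b).Reachable i j ∧
    ((a.partner i = i ∧ a.partner j = j) ∨ (b.partner i = i ∧ b.partner j = j))

/-- The number of closed loops in the glued diagram: the number of components without any
through-string. -/
noncomputable def glueLoops {n : ℕ} (a b : HalfDiagram n) : ℕ :=
  Set.ncard {c : (glue a b).ConnectedComponent |
    ∀ i ∈ c.supp, a.partner i ≠ i ∧ b.partner i ≠ i}

open Classical in
/-- `⟨ξ_a, ξ_b⟩`. -/
noncomputable def gram (q : ℝ) {n : ℕ} (a b : HalfDiagram n) : ℂ :=
  if SameSideJoined a b then 0 else (q : ℂ) ^ glueLoops a b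

/-- The sesquilinear form on `U(n)`, linear in the first and conjugate linear in the second
argument. -/
noncomputable def form (q : ℝ) {n : ℕ} (v w : U n) : ℂ :=
  ∑ a, ∑ b, v a * (starRingEnd ℂ) (w b) * gram q a b

/-! ### Brackets, heights, maxima and minima -/

namespace HalfDiagram

variable {n : ℕ}

/-- The bracket at a point is opening if the point carries a through-string or is paired with a
later point; otherwise it is closing. -/
def IsOpening (a : HalfDiagram n) (k : Fin n) : Prop := k ≤ a.partner k

instance (a : HalfDiagram n) (k : Fin n) : Decidable (a.IsOpening k) :=
  inferInstanceAs (Decidable (k ≤ a.partner k))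

/-- The number of opening brackets among the first `i` brackets. -/
def openings (a : HalfDiagram n) (i : ℕ) : ℕ :=
  (Finset.univ.filter fun k : Fin n => k.val < i ∧ a.IsOpening k).card

/-- The number of closing brackets among the first `i` brackets. -/
def closings (a : HalfDiagram n) (i : ℕ) : ℕ :=
  (Finset.univ.filter fun k : Fin n => k.val < i ∧ ¬ a.IsOpening k).card

/-- So the subtraction in `height` never truncates. -/
theorem closings_le_openings (a : HalfDiagram n) (i : ℕ) : a.closings i ≤ a.openings i := by
  apply Finset.card_le_card_of_injOn a.partner
  · intro k hk
    simp only [IsOpening, Finset.coe_filter, Finset.mem_univ, true_and, Set.mem_ofPred_eq,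
      a.partner_partner, Fin.le_def, not_le] at hk ⊢
    omega
  · intro x _ y _ hxy
    rw [← a.partner_partner x, hxy, a.partner_partner]

/-- The height `h_i(a)`: the number of opening brackets minus the number of closing brackets
among the first `i` brackets. -/
def height (a : HalfDiagram n) (i : ℕ) : ℕ := a.openings i - a.closings i

/-- The path of `a` has a maximum at `i`. -/
def IsMaximum (a : HalfDiagram n) (i : ℕ) : Prop :=
  0 < i ∧ i < n ∧ a.height (i - 1) < a.height i ∧ a.height (i + 1) < a.height i

/-- The path of `a` has a minimum at the interior position `i`. -/
def IsMinimum (a : HalfDiagram n) (i : ℕ) : Prop :=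
  0 < i ∧ i < n ∧ a.height i < a.height (i - 1) ∧ a.height i < a.height (i + 1)

instance (a : HalfDiagram n) (i : ℕ) : Decidable (a.IsMaximum i) :=
  inferInstanceAs (Decidable (_ ∧ _))

instance (a : HalfDiagram n) (i : ℕ) : Decidable (a.IsMinimum i) :=
  inferInstanceAs (Decidable (_ ∧ _))

/-- The positions of the maxima of `a`. -/
def maxima (a : HalfDiagram n) : Finset ℕ := (Finset.range n).filter a.IsMaximum

/-- The positions of the minima of `a`, where `n` counts as a minimum if the last step is
decreasing. -/
def minima (a : HalfDiagram n) : Finset ℕ :=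
  (Finset.range (n + 1)).filter fun i =>
    a.IsMinimum i ∨ (0 < n ∧ i = n ∧ a.height n < a.height (n - 1))

/-- `a` is the minimal element `(1, …, 1)` (for its number of arches): the height before each
closing bracket is `1`. -/
def IsMinimal (a : HalfDiagram n) : Prop := ∀ k : Fin n, ¬ a.IsOpening k → a.height k.val = 1

/-- `b` is the result of box addition at `i` on `a`: `a` has a minimum at `i`, and the path of `b`
is that of `a` with the `i`th step replaced by an upward step and the `(i + 1)`th step replaced by
a downward step. -/
structure IsBoxAddition (i : ℕ) (a b : HalfDiagram n) : Prop where
  isMinimum : a.IsMinimum i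
  up : ∀ k : Fin n, k.val + 1 = i → b.IsOpening k
  down : ∀ k : Fin n, k.val = i → ¬ b.IsOpening k
  same : ∀ k : Fin n, k.val + 1 ≠ i → k.val ≠ i → (b.IsOpening k ↔ a.IsOpening k)

end HalfDiagram

/-! ### Chebyshev polynomials and the second basis -/

/-- `Δ_m(q)`: the determinant of the `m × m` matrix with diagonal entries `q`, sub- and
superdiagonal entries `1`, and all other entries `0`. -/
noncomputable def cheb (q : ℝ) (m : ℕ) : ℝ :=
  Matrix.det (Matrix.of fun i j : Fin m =>
    if i = j then q else if i.val + 1 = j.val ∨ j.val + 1 = i.val then 1 else 0)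

/-- `μ_m = Δ_{m-1} / Δ_m`, for `m ≥ 1`. -/
noncomputable def mu (q : ℝ) (m : ℕ) : ℝ := cheb q (m - 1) / cheb q m

/-- `WhiteBox q a v`: the vector `v` is obtained from a vector `ξ_(1,…,1)` by applying the
operators `e_i - μ_{h_i + 1}` along some sequence of box additions that leads from `(1,…,1)`
to `a`. -/
inductive WhiteBox (q : ℝ) {n : ℕ} : HalfDiagram n → U n → Prop
  | minimal {a : HalfDiagram n} (ha : a.IsMinimal) : WhiteBox q a (xi a)
  | box {i : ℕ} {a b : HalfDiagram n} {v : U n} (hv : WhiteBox q a v)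
      (hb : HalfDiagram.IsBoxAddition i a b) :
      WhiteBox q b
        (act q (gen n i hb.isMinimum.1 hb.isMinimum.2.1) v - (mu q (a.height i + 1) : ℂ) • v)

open Classical in
/-- The vector `ξ'_a` of the second basis.  (A vector as in `WhiteBox` exists for every `a`, and
it does not depend on the sequence of box additions.) -/
noncomputable def xi' (q : ℝ) {n : ℕ} (a : HalfDiagram n) : U n :=
  if h : ∃ v, WhiteBox q a v then h.choose else 0

end TemperleyLieb

/-! ### The three-term recursion for the determinants -/

namespace TemperleyLieb

/-! The vectors `xi' q a` are orthogonal, and adding one box multiplies the squared norm by an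
explicit factor. Let `b` arise from `a` by a box at `i`, put `h = h_i(a)`, `e = e_i` and `μ =
μ_{h+1}`, so that `ξ'_b = (e - μ) ξ'_a`. From `e² = q e` one gets `e ξ'_b = (q - μ)(ξ'_b + μ ξ'_a)`.
As `e` is self-adjoint and `ξ'_a ⊥ ξ'_b`, this gives `⟨ξ'_b, ξ'_b⟩ = ⟨ξ'_a, e ξ'_b⟩ = (q - μ) μ
⟨ξ'_a, ξ'_a⟩`, and by the recursion for `Δ` the factor is `Δ_{h+2} Δ_h / Δ_{h+1}²`. The product over
all closing brackets of `Δ` of the height before divided by `Δ` of the height after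
(`closingProduct`) changes by the same factor, and for minimal diagrams both sides are `q` to the
number of arches. Along each descending run this product telescopes to its top over its bottom, that
is, to maxima over minima (`closingProduct_eq`).

Orthogonality (`form_xi'_of_ne`) is an induction on the total number of boxes, guided by the first
step at which the two paths differ. It rests on how `e_i` acts on `ξ'_a`: at a slope it kills the
vector (`E_xi'_of_slope`), and at a maximum of height 1 it multiplies it by `q`
(`E_xi'_of_height_eq_one`). The slope statement is where the values of `μ` matter: it reduces to
`μ_{h+1}(q - μ_h) = 1` through the relation `e_i e_{i±1} e_i = e_i`.

The Temperley–Lieb relations and self-adjointness come from the definition by graph components.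
Attaching `e_i` is described as an explicit modification `cup` of the pairing with a coefficient
`cupCoeff` (`act_gen_xi`); the relations then become case checks on involutions. Self-adjointness
holds because both `⟨e_i ξ_a, ξ_b⟩` and `⟨ξ_a, e_i ξ_b⟩` count the loops of the same picture, `e_i`
sandwiched between `a` and `b`. -/

theorem cheb_zero (q : ℝ) : cheb q 0 = 1 := by simp [cheb]

theorem cheb_one (q : ℝ) : cheb q 1 = q := by simp [cheb]

/-- Expansion along the first row leaves two minors; the second one has a single nonzero entry in
its first column and is expanded along that. -/
theorem cheb_add_two (q : ℝ) (m : ℕ) : cheb q (m + 2) = q * cheb q (m + 1) - cheb q m := by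
  unfold cheb
  rw [Matrix.det_succ_row_zero, Fin.sum_univ_succ, Fin.sum_univ_succ, Finset.sum_eq_zero]
  · have h1 : (Matrix.of fun i j : Fin (m + 2) =>
        if i = j then q else if i.val + 1 = j.val ∨ j.val + 1 = i.val then (1 : ℝ) else 0).submatrix
          Fin.succ (Fin.succAbove 0) = Matrix.of fun i j : Fin (m + 1) =>
        if i = j then q else if i.val + 1 = j.val ∨ j.val + 1 = i.val then 1 else 0 := by
      ext i j
      simp [Fin.ext_iff]
    have h2 : ((Matrix.of fun i j : Fin (m + 2) =>
        if i = j then q else if i.val + 1 = j.val ∨ j.val + 1 = i.val then (1 : ℝ) else 0).submatrix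
          Fin.succ (Fin.succAbove (Fin.succ 0))).det = (Matrix.of fun i j : Fin m =>
        if i = j then q else if i.val + 1 = j.val ∨ j.val + 1 = i.val then (1 : ℝ) else 0).det := by
      rw [Matrix.det_succ_column_zero, Fin.sum_univ_succ, Finset.sum_eq_zero]
      · simp only [Fin.val_zero, pow_zero, one_mul, add_zero, Matrix.submatrix_apply,
          Matrix.of_apply, Matrix.submatrix_submatrix]
        rw [show (Matrix.of fun i j : Fin m =>
          if i = j then q else if i.val + 1 = j.val ∨ j.val + 1 = i.val then (1 : ℝ) else 0) = _ from ?_]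
        · norm_num [Fin.ext_iff]
          rfl
        · ext i j
          simp [Fin.ext_iff, Fin.succAbove, Fin.lt_def]
      · intro i _
        simp [Fin.ext_iff, Fin.succAbove]
    rw [h1, h2]
    simp [Fin.ext_iff]
    ring
  · intro i _
    simp [Fin.ext_iff]

end TemperleyLieb

/-! ### Half-diagrams as lattice paths -/

namespace TemperleyLieb
namespace HalfDiagram
variable {n : ℕ}

/-- The step of the path of `a` from `k` to `k + 1` is upward. -/
def Up (a : HalfDiagram n) (k : ℕ) : Prop := ∃ h : k < n, a.IsOpening ⟨k, h⟩

/-- The step of the path of `a` from `k` to `k + 1` is downward. -/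
def Down (a : HalfDiagram n) (k : ℕ) : Prop := ∃ h : k < n, ¬ a.IsOpening ⟨k, h⟩

instance (a : HalfDiagram n) (k : ℕ) : Decidable (a.Up k) := by unfold Up; infer_instance

instance (a : HalfDiagram n) (k : ℕ) : Decidable (a.Down k) := by unfold Down; infer_instance

theorem Up.lt {a : HalfDiagram n} {k : ℕ} (h : a.Up k) : k < n := h.1

theorem Down.lt {a : HalfDiagram n} {k : ℕ} (h : a.Down k) : k < n := h.1

theorem Up.not_down {a : HalfDiagram n} {k : ℕ} (h : a.Up k) : ¬ a.Down k := fun h' => h'.2 h.2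

theorem Down.not_up {a : HalfDiagram n} {k : ℕ} (h : a.Down k) : ¬ a.Up k := fun h' => h.2 h'.2

theorem up_or_down (a : HalfDiagram n) {k : ℕ} (h : k < n) : a.Up k ∨ a.Down k := by
  by_cases h' : a.IsOpening ⟨k, h⟩
  · exact .inl ⟨h, h'⟩
  · exact .inr ⟨h, h'⟩

theorem height_zero (a : HalfDiagram n) : a.height 0 = 0 := by simp [height, openings]

theorem Up.height_succ {a : HalfDiagram n} {k : ℕ} (h : a.Up k) :
    a.height (k + 1) = a.height k + 1 := by
  obtain ⟨h, h'⟩ := h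
  have h1 : a.openings (k + 1) = a.openings k + 1 := by
    unfold openings
    rw [← Finset.card_insert_of_notMem (a := (⟨k, h⟩ : Fin n)) (by simp)]
    congr 1
    ext x
    simp only [Finset.mem_filter, Finset.mem_univ, true_and, Finset.mem_insert, Fin.ext_iff]
    constructor
    · rintro ⟨hx, ho⟩
      by_cases hk : x.val = k
      · exact .inl hk
      · exact .inr ⟨by omega, ho⟩
    · rintro (hx | ⟨hx, ho⟩)
      · obtain rfl : x = ⟨k, h⟩ := Fin.ext hx
        exact ⟨by simp, h'⟩
      · exact ⟨by omega, ho⟩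
  have h2 : a.closings (k + 1) = a.closings k := by
    unfold closings
    congr 1
    ext x
    simp only [Finset.mem_filter, Finset.mem_univ, true_and]
    refine and_congr_left fun ho => ⟨fun hx => ?_, fun hx => by omega⟩
    by_contra hk
    exact ho ((Fin.ext (show x.val = k by omega) : x = ⟨k, h⟩) ▸ h')
  have := a.closings_le_openings k
  simp only [height, h1, h2]
  omega

theorem Down.height_succ {a : HalfDiagram n} {k : ℕ} (h : a.Down k) :
    a.height (k + 1) + 1 = a.height k := by
  obtain ⟨h, h'⟩ := h
  have h1 : a.closings (k + 1) = a.closings k + 1 := by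
    unfold closings
    rw [← Finset.card_insert_of_notMem (a := (⟨k, h⟩ : Fin n)) (by simp)]
    congr 1
    ext x
    simp only [Finset.mem_filter, Finset.mem_univ, true_and, Finset.mem_insert, Fin.ext_iff]
    constructor
    · rintro ⟨hx, ho⟩
      by_cases hk : x.val = k
      · exact .inl hk
      · exact .inr ⟨by omega, ho⟩
    · rintro (hx | ⟨hx, ho⟩)
      · obtain rfl : x = ⟨k, h⟩ := Fin.ext hx
        exact ⟨by simp, h'⟩
      · exact ⟨by omega, ho⟩
  have h2 : a.openings (k + 1) = a.openings k := by
    unfold openings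
    congr 1
    ext x
    simp only [Finset.mem_filter, Finset.mem_univ, true_and]
    refine and_congr_left fun ho => ⟨fun hx => ?_, fun hx => by omega⟩
    by_contra hk
    exact h' ((Fin.ext (show x.val = k by omega) : x = ⟨k, h⟩) ▸ ho)
  have := a.closings_le_openings (k + 1)
  simp only [height, h1, h2] at this ⊢
  omega

theorem up_iff_height_lt {a : HalfDiagram n} {k : ℕ} (h : k < n) :
    a.Up k ↔ a.height k < a.height (k + 1) := by
  rcases a.up_or_down h with h' | h'
  · simp [h', h'.height_succ]
  · simp [h'.not_up, ← h'.height_succ]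

theorem down_iff_height_lt {a : HalfDiagram n} {k : ℕ} (h : k < n) :
    a.Down k ↔ a.height (k + 1) < a.height k := by
  rcases a.up_or_down h with h' | h'
  · simp [h'.not_down, h'.height_succ]
  · simp [h', ← h'.height_succ]

theorem isMaximum_succ {a : HalfDiagram n} {p : ℕ} :
    a.IsMaximum (p + 1) ↔ a.Up p ∧ a.Down (p + 1) := by
  constructor
  · rintro ⟨-, h, h1, h2⟩
    exact ⟨(up_iff_height_lt (by omega)).2 h1, (down_iff_height_lt h).2 h2⟩
  · rintro ⟨h1, h2⟩
    exact ⟨p.succ_pos, h2.lt, (up_iff_height_lt h1.lt).1 h1, (down_iff_height_lt h2.lt).1 h2⟩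

theorem isMinimum_succ {a : HalfDiagram n} {p : ℕ} :
    a.IsMinimum (p + 1) ↔ a.Down p ∧ a.Up (p + 1) := by
  constructor
  · rintro ⟨-, h, h1, h2⟩
    exact ⟨(down_iff_height_lt (by omega)).2 h1, (up_iff_height_lt h).2 h2⟩
  · rintro ⟨h1, h2⟩
    exact ⟨p.succ_pos, h2.lt, (down_iff_height_lt h1.lt).1 h1, (up_iff_height_lt h2.lt).1 h2⟩

theorem isMinimal_iff {a : HalfDiagram n} : a.IsMinimal ↔ ∀ k, a.Down k → a.height k = 1 :=
  ⟨fun h k hk => h ⟨k, hk.1⟩ hk.2, fun h k hk => h k ⟨k.2, hk⟩⟩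

theorem isBoxAddition_succ {a b : HalfDiagram n} {p : ℕ} :
    IsBoxAddition (p + 1) a b ↔ (a.Down p ∧ a.Up (p + 1)) ∧ (b.Up p ∧ b.Down (p + 1)) ∧
      ∀ k, k ≠ p → k ≠ p + 1 → (b.Up k ↔ a.Up k) := by
  constructor
  · intro h
    have hm := isMinimum_succ.1 h.isMinimum
    refine ⟨hm, ⟨⟨hm.1.lt, h.up _ rfl⟩, ⟨hm.2.lt, h.down _ rfl⟩⟩, fun k h1 h2 => ?_⟩
    exact exists_congr fun hk => h.same ⟨k, hk⟩ (by simpa using h1) h2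
  · rintro ⟨h1, ⟨h2, h3⟩, h4⟩
    refine ⟨isMinimum_succ.2 h1, fun k hk => ?_, fun k hk => ?_, fun k h5 h6 => ?_⟩
    · obtain rfl : k = ⟨p, h2.lt⟩ := Fin.ext (by simpa using hk)
      exact h2.2
    · obtain rfl : k = ⟨p + 1, h3.lt⟩ := Fin.ext (by simpa using hk)
      exact h3.2
    · have := h4 k (by omega) h6
      simpa [Up] using this

/-- A half-diagram is determined by its opening brackets. -/
theorem eq_of_up_iff {a b : HalfDiagram n} (h : ∀ k, a.Up k ↔ b.Up k) : a = b := by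
  have hop : ∀ k : Fin n, k ≤ a.partner k ↔ k ≤ b.partner k := fun k => by
    simpa [Up, IsOpening] using h k
  -- If the `b`-partner `y` of a closing bracket `k` lay strictly inside the `a`-arch ending at `k`,
  -- then `y` would open in `a` too. It cannot be a through-string of `a` under that arch, its
  -- `a`-partner cannot lie beyond `k`, and an `a`-partner before `k` would by induction also be its
  -- `b`-partner, which is `k`.
  have key : ∀ (a b : HalfDiagram n) (_ : ∀ k : Fin n, k ≤ a.partner k ↔ k ≤ b.partner k) (k : Fin n),
      (∀ z, z < k → a.partner z < z → a.partner z = b.partner z) → a.partner k < k →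
      ¬ a.partner k < b.partner k := by
    intro a b hop k ih hk hlt
    have hk' : b.partner k < k := by have := hop k; omega
    have hy := hop (b.partner k)
    rw [b.partner_partner] at hy
    have hy' := hy.2 hk'.le
    rcases hy'.eq_or_lt with hfix | hlt'
    · exact a.no_through_crossing _ _ _ hlt hk' (a.partner_partner k) hfix.symm
    · rcases lt_trichotomy (a.partner (b.partner k)) k with hz | hz | hz
      · have := ih _ hz (by rwa [a.partner_partner])
        rw [a.partner_partner] at this
        have h2 := congrArg b.partner this
        rw [b.partner_partner, b.partner_partner] at h2
        omega
      · have h2 := congrArg a.partner hz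
        rw [a.partner_partner] at h2
        omega
      · exact a.no_crossing _ _ _ _ hlt hk' hz (a.partner_partner k) rfl
  have hcl : ∀ m, ∀ k : Fin n, k.val = m → a.partner k < k → a.partner k = b.partner k := by
    intro m
    induction m using Nat.strong_induction_on with
    | _ m ih =>
      rintro k rfl hk
      have h1 := key a b hop k (fun z hz => ih z hz z rfl) hk
      have h2 := key b a (fun k => (hop k).symm) k
        (fun z hz hz' => (ih z hz z rfl (by have := hop z; omega)).symm)
        (by have := hop k; omega)
      omega
  have hopn : ∀ (a b : HalfDiagram n) (_ : ∀ k : Fin n, a.partner k < k → a.partner k = b.partner k)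
      (x : Fin n), x < a.partner x → a.partner x = b.partner x := by
    intro a b hcl x hx
    have := hcl (a.partner x) (by rwa [a.partner_partner])
    rw [a.partner_partner] at this
    conv_rhs => rw [this, b.partner_partner]
  have hcl' : ∀ k : Fin n, a.partner k < k → a.partner k = b.partner k := fun k => hcl k k rfl
  have hcl'' : ∀ k : Fin n, b.partner k < k → b.partner k = a.partner k := fun k hk =>
    (hcl' k (by have := hop k; omega)).symm
  ext1
  funext x
  rcases lt_trichotomy (a.partner x) x with hx | hx | hx
  · exact hcl' x hx
  · rcases lt_trichotomy (b.partner x) x with hx' | hx' | hx'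
    · exact (hcl'' x hx').symm
    · rw [hx, hx']
    · exact (hopn b a hcl'' x hx').symm
  · exact hopn a b hcl' x hx

/-- Otherwise the arch closing at `p + 1` starts before `p` and spans it, so `p` would be a
through-string under an arch or start a crossing arch. -/
theorem partner_of_up_down {a : HalfDiagram n} {p : ℕ} (h1 : a.Up p) (h2 : a.Down (p + 1)) :
    a.partner ⟨p, h1.lt⟩ = ⟨p + 1, h2.lt⟩ := by
  obtain ⟨hp, h1⟩ := h1
  obtain ⟨hq, h2⟩ := h2
  simp only [IsOpening, not_le] at h1 h2
  by_contra hne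
  have h3 : a.partner ⟨p + 1, hq⟩ ≠ ⟨p, hp⟩ := fun h => hne (by rw [← h, a.partner_partner])
  simp only [Fin.le_def, Fin.lt_def, ne_eq, Fin.ext_iff] at h1 h2 h3 hne
  have h4 : a.partner ⟨p + 1, hq⟩ < ⟨p, hp⟩ := by simp only [Fin.lt_def]; omega
  have h5 : (⟨p, hp⟩ : Fin n) < ⟨p + 1, hq⟩ := by simp [Fin.lt_def]
  by_cases hf : a.partner ⟨p, hp⟩ = ⟨p, hp⟩
  · exact a.no_through_crossing _ _ _ h4 h5 (a.partner_partner _) hf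
  · refine a.no_crossing _ _ _ (a.partner ⟨p, hp⟩) h4 h5 ?_ (a.partner_partner _) rfl
    simp only [Fin.ext_iff] at hf
    simp only [Fin.lt_def]; omega

/-- At positive height, some bracket to the left is matched to none on the left. -/
theorem exists_unmatched {a : HalfDiagram n} {p : ℕ} (h : 0 < a.height p) :
    ∃ x : Fin n, x.val < p ∧ x ≤ a.partner x ∧ ¬ (x < a.partner x ∧ (a.partner x).val < p) := by
  by_contra! hx
  -- If every opening bracket before `p` were matched before `p`, `partner` would inject the
  -- openings into the closings and the height could not be positive.
  have : a.openings p ≤ a.closings p := by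
    apply Finset.card_le_card_of_injOn a.partner
    · intro k hk
      obtain ⟨-, hk, ho⟩ := Finset.mem_filter.1 (Finset.mem_coe.1 hk)
      simpa [IsOpening, a.partner_partner] using (hx k hk ho).symm
    · intro x _ y _ hxy
      rw [← a.partner_partner x, hxy, a.partner_partner]
  unfold height at h
  omega

end HalfDiagram
end TemperleyLieb

/-! ### Removing and adding boxes -/

namespace TemperleyLieb
namespace HalfDiagram
variable {n : ℕ}

/-- Box addition can be undone at any maximum of height at least 2. The small arch at `p`, `p + 1`
is cut open and joined to the strand `x` immediately enclosing it, or to the nearest through-string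
on its left if that comes first: `x` is paired with `p`, and `p + 1` inherits the former partner of
`x`, or becomes a through-string if `x` was one. -/
theorem exists_removal {b : HalfDiagram n} {p : ℕ} (h1 : b.Up p) (h2 : b.Down (p + 1))
    (h : 2 ≤ b.height (p + 1)) : ∃ a, IsBoxAddition (p + 1) a b := by
  have hPQ := partner_of_up_down h1 h2
  -- `x` is the last opening bracket before `p` that is not matched before `p`; it exists because
  -- the height at `p` is at least 1. By maximality, everything opening strictly between `x` and `p`
  -- is matched before `p`, which excludes new crossings.
  obtain ⟨x, hx, hmax⟩ := (Finset.univ.filter fun x : Fin n => x.val < p ∧ x ≤ b.partner x ∧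
      ¬ (x < b.partner x ∧ (b.partner x).val < p)).exists_max_image id (by
    obtain ⟨x, hx⟩ := exists_unmatched (a := b) (p := p) (by have := h1.height_succ; omega)
    exact ⟨x, by simpa using hx⟩)
  simp only [Finset.mem_filter, Finset.mem_univ, true_and, id] at hx hmax
  obtain ⟨hxp, hx1, hx2⟩ := hx
  have hp := h1.lt
  have hq := h2.lt
  set P : Fin n := ⟨p, hp⟩ with hP
  set Q : Fin n := ⟨p + 1, hq⟩ with hQ
  have hQP : b.partner Q = P := by rw [← hPQ, b.partner_partner]
  have hPv : P.val = p := rfl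
  have hQv : Q.val = p + 1 := rfl
  clear_value P Q
  have hmax' : ∀ u : Fin n, x < u → u.val < p → u ≤ b.partner u →
      u < b.partner u ∧ (b.partner u).val < p := by
    intro u h1 h2 h3
    by_contra h4
    exact absurd (hmax u ⟨h2, h3, h4⟩) (by omega)
  have hy : b.partner x = x ∨ Q < b.partner x := by
    have e1 : b.partner x ≠ P := fun e => by
      have := congrArg b.partner e
      rw [b.partner_partner, hPQ] at this
      omega
    have e2 : b.partner x ≠ Q := fun e => by
      have := congrArg b.partner e
      rw [b.partner_partner, hQP] at this
      omega
    omega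
  have hinv := b.partner_partner
  have hbeq : ∀ u v : Fin n, b.partner u = v → b.partner v = u := by
    rintro u v rfl; exact hinv u
  let σ : Fin n → Fin n := fun z =>
    if z = P then x else if z = x then P else
    if z = Q then (if b.partner x = x then Q else b.partner x) else
    if z = b.partner x then Q else b.partner z
  have hσ : ∀ z, σ z = if z = P then x else if z = x then P else
    if z = Q then (if b.partner x = x then Q else b.partner x) else
    if z = b.partner x then Q else b.partner z := fun z => rfl
  have nc := b.no_crossing
  have nt := b.no_through_crossing
  have hσσ : ∀ z, σ (σ z) = z := by
    intro z
    simp only [hσ]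
    grind
  refine ⟨⟨σ, hσσ, ?_, ?_⟩, isBoxAddition_succ.2 ⟨⟨⟨hp, ?_⟩, ⟨hq, ?_⟩⟩, ⟨h1, h2⟩, ?_⟩⟩
  · intro i j k l hik hkj hjl hi hk
    have e1 := nc i (b.partner i) k (b.partner k)
    have := nc i (b.partner i) x (b.partner x)
    have := nc x (b.partner x) k (b.partner k)
    have := nc k (b.partner k) x (b.partner x)
    have := nc x (b.partner x) i (b.partner i)
    have := nc x (b.partner x) j (b.partner j)
    have := nt i (b.partner i) x
    have := nt k (b.partner k) x
    have := hmax' i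
    have := hmax' j
    have := hmax' k
    have := hmax' l
    simp only [hσ] at hi hk
    clear hmax nc nt hmax'
    grind
  · intro i j k hik hkj hi hk
    have := nc i (b.partner i) x (b.partner x)
    have := nc x (b.partner x) i (b.partner i)
    have := nt i (b.partner i) x
    have := nt i (b.partner i) k
    have := nt x (b.partner x) k
    have := hmax' i
    have := hmax' k
    simp only [hσ] at hi hk
    clear hmax nc nt hmax'
    grind
  · simp only [IsOpening, hσ]
    grind
  · simp only [IsOpening, hσ]
    grind
  · intro k hk1 hk2
    refine exists_congr fun hk => ?_
    simp only [IsOpening, hσ]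
    grind

/-- The size of `a`, which increases by one under box addition. -/
def size (a : HalfDiagram n) : ℕ := ∑ k ∈ Finset.range n, if a.Down k then k else 0

theorem IsBoxAddition.size_eq {a b : HalfDiagram n} {p : ℕ} (h : IsBoxAddition (p + 1) a b) :
    b.size = a.size + 1 := by
  obtain ⟨⟨h1, h2⟩, ⟨h3, h4⟩, h5⟩ := isBoxAddition_succ.1 h
  have hs : ∀ k, k ∈ Finset.range n → k ≠ p → k ≠ p + 1 → (b.Down k ↔ a.Down k) := by
    intro k hk e1 e2
    have := a.up_or_down (Finset.mem_range.1 hk)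
    have := b.up_or_down (Finset.mem_range.1 hk)
    have := h5 k e1 e2
    have := fun h : a.Up k => h.not_down
    have := fun h : b.Up k => h.not_down
    tauto
  have split : ∀ c : HalfDiagram n, c.size = (if c.Down p then p else 0) +
      ((if c.Down (p + 1) then p + 1 else 0) +
        ∑ k ∈ ((Finset.range n).erase p).erase (p + 1), if c.Down k then k else 0) := by
    intro c
    rw [Finset.add_sum_erase _ (fun k => if c.Down k then k else 0) (by simpa using h2.lt),
      Finset.add_sum_erase _ (fun k => if c.Down k then k else 0) (by simpa using h1.lt), size]
  rw [split a, split b, if_pos h1, if_neg h2.not_down, if_neg h3.not_down, if_pos h4]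
  rw [Finset.sum_congr rfl fun k hk => if_congr (hs k (by aesop) (by aesop) (by aesop)) rfl rfl]
  omega

/-- The descending run containing the step is followed backwards to its top, which exists because
the path starts at height 0. -/
theorem Down.exists_maximum {a : HalfDiagram n} {k : ℕ} (h : a.Down k) :
    ∃ p, p + 1 ≤ k ∧ a.Up p ∧ a.Down (p + 1) ∧ a.height k ≤ a.height (p + 1) := by
  induction k with
  | zero => have := h.height_succ; simp [height_zero] at this
  | succ j ih =>
    rcases a.up_or_down (show j < n by have := h.lt; omega) with hj | hj
    · exact ⟨j, le_rfl, hj, h, le_rfl⟩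
    · obtain ⟨p, h1, h2, h3, h4⟩ := ih hj
      exact ⟨p, by omega, h2, h3, by have := hj.height_succ; omega⟩

theorem exists_maximum_of_not_isMinimal {a : HalfDiagram n} (h : ¬ a.IsMinimal) :
    ∃ p, a.Up p ∧ a.Down (p + 1) ∧ 2 ≤ a.height (p + 1) := by
  rw [isMinimal_iff] at h
  push Not at h
  obtain ⟨k, hk, hne⟩ := h
  obtain ⟨p, -, h2, h3, h4⟩ := hk.exists_maximum
  exact ⟨p, h2, h3, by have := hk.height_succ; omega⟩

theorem down_iff {a : HalfDiagram n} {k : ℕ} : a.Down k ↔ k < n ∧ ¬ a.Up k :=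
  ⟨fun h => ⟨h.lt, h.not_up⟩, fun h => (a.up_or_down h.1).resolve_left h.2⟩

theorem height_congr {a b : HalfDiagram n} {i : ℕ} (hi : i ≤ n) (h : ∀ k < i, a.Up k ↔ b.Up k) :
    a.height i = b.height i := by
  induction i with
  | zero => simp [height_zero]
  | succ i ih =>
    have ih := ih (by omega) fun k hk => h k (by omega)
    rcases a.up_or_down (show i < n by omega) with hu | hd
    · have := hu.height_succ
      have := ((h i (by omega)).1 hu).height_succ
      omega
    · have := hd.height_succ
      have := (down_iff.2 ⟨hd.lt, (h i (by omega)).not.1 hd.not_up⟩).height_succ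
      omega

theorem IsBoxAddition.height_eq {a b : HalfDiagram n} {p : ℕ} (h : IsBoxAddition (p + 1) a b)
    (k : ℕ) (hkn : k ≤ n) : b.height k = a.height k + if k = p + 1 then 2 else 0 := by
  obtain ⟨⟨h1, h2⟩, ⟨h3, h4⟩, h5⟩ := isBoxAddition_succ.1 h
  have hstep : ∀ k < n, k ≠ p → k ≠ p + 1 →
      b.height (k + 1) + a.height k = a.height (k + 1) + b.height k := by
    intro k hk e1 e2
    rcases a.up_or_down hk with hu | hd
    · have := hu.height_succ
      have := ((h5 k e1 e2).2 hu).height_succ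
      omega
    · have := hd.height_succ
      have := ((b.up_or_down hk).resolve_left fun hu => hd.not_up ((h5 k e1 e2).1 hu)).height_succ
      omega
  have e1 := h1.height_succ
  have e2 := h2.height_succ
  have e3 := h3.height_succ
  have e4 := h4.height_succ
  induction k with
  | zero => simp [height_zero]
  | succ k ih =>
    have ih := ih (by omega)
    by_cases hp : k = p
    · subst hp; simp at ih ⊢; omega
    · by_cases hq : k = p + 1
      · subst hq; simp at ih ⊢; omega
      · have := hstep k (by omega) hp hq
        simp [hp, hq] at ih ⊢; omega

end HalfDiagram
end TemperleyLieb

/-! ### Attaching a generator to an involution -/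

namespace TemperleyLieb

section Cup
variable {α : Type*} [DecidableEq α]

/-- The pairing `σ` with a cap and a cup attached at `P` and `Q`. -/
def cup (σ : α → α) (P Q x : α) : α :=
  if x = P then Q else if x = Q then P else
  if σ x = P then (if σ Q = Q then x else σ Q) else
  if σ x = Q then (if σ P = P then x else σ P) else σ x

theorem cup_comm (σ : α → α) (P Q : α) (hσ : Function.Involutive σ) : cup σ P Q = cup σ Q P := by
  funext x
  unfold cup
  have := hσ P
  grind

theorem cup_involutive {σ : α → α} (hσ : Function.Involutive σ) {P Q : α} (hPQ : P ≠ Q) :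
    Function.Involutive (cup σ P Q) := by
  intro x
  have : ∀ x, σ (σ x) = x := hσ
  unfold cup
  grind

theorem cup_eq_self {σ : α → α} (hσ : Function.Involutive σ) {P Q : α} (h : σ P = Q) :
    cup σ P Q = σ := by
  funext x
  have : ∀ x, σ (σ x) = x := hσ
  unfold cup
  grind

theorem cup_cup_cup {σ : α → α} (hσ : Function.Involutive σ) {P Q R : α} (h1 : P ≠ Q) (h2 : Q ≠ R)
    (h3 : P ≠ R) : cup (cup (cup σ P Q) Q R) P Q = cup σ P Q := by
  funext x
  have : ∀ x, σ (σ x) = x := hσ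
  unfold cup
  grind

/-- The coefficient with which attaching a cap at `P` and `Q` acts on `σ`. -/
noncomputable def cupCoeff (q : ℝ) (σ : α → α) (P Q : α) : ℝ :=
  if σ P = P ∧ σ Q = Q then 0 else if σ P = Q then q else 1

theorem cupCoeff_comm (q : ℝ) {σ : α → α} (hσ : Function.Involutive σ) (P Q : α) :
    cupCoeff q σ P Q = cupCoeff q σ Q P := by
  have : ∀ x, σ (σ x) = x := hσ
  unfold cupCoeff
  grind

theorem cupCoeff_cup (q : ℝ) {σ : α → α} {P Q : α} (h : P ≠ Q) :
    cupCoeff q (cup σ P Q) P Q = q := by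
  unfold cupCoeff cup
  grind

/-- After capping at `P`, `Q` these two are paired with each other, so `Q`, `R` are neither paired
nor both through-strings; the same argument applies after the second cap. -/
theorem cupCoeff_cup_adjacent (q : ℝ) {σ : α → α} (hσ : Function.Involutive σ) {P Q R : α}
    (h1 : P ≠ Q) (h2 : Q ≠ R) (h3 : P ≠ R) :
    cupCoeff q (cup σ P Q) Q R = 1 ∧ cupCoeff q (cup (cup σ P Q) Q R) P Q = 1 := by
  have : ∀ x, σ (σ x) = x := hσ
  unfold cupCoeff cup
  grind

theorem cupCoeff_mul_comm (q : ℝ) {σ : α → α} (hσ : Function.Involutive σ) {P Q R S : α}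
    (h1 : P ≠ Q) (h2 : R ≠ S) (h3 : P ≠ R) (h4 : P ≠ S) (h5 : Q ≠ R) (h6 : Q ≠ S) :
    cupCoeff q σ P Q * cupCoeff q (cup σ P Q) R S =
      cupCoeff q σ R S * cupCoeff q (cup σ R S) P Q := by
  have : ∀ x, σ (σ x) = x := hσ
  unfold cupCoeff cup
  grind (splits := 30)

/-- The hypothesis says that no two through-strings are joined (and that no loop has value 0). If
the product of coefficients vanishes, the resulting involutions are irrelevant to the operators. -/
theorem cup_cup_comm (q : ℝ) {σ : α → α} (hσ : Function.Involutive σ) {P Q R S : α}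
    (h1 : P ≠ Q) (h2 : R ≠ S) (h3 : P ≠ R) (h4 : P ≠ S) (h5 : Q ≠ R) (h6 : Q ≠ S)
    (h : cupCoeff q σ P Q * cupCoeff q (cup σ P Q) R S ≠ 0) :
    cup (cup σ P Q) R S = cup (cup σ R S) P Q := by
  have : ∀ x, σ (σ x) = x := hσ
  have hP : ¬ (σ P = P ∧ σ Q = Q) := fun h' => h (by simp [cupCoeff, h'])
  have hR : ¬ (cup σ P Q R = R ∧ cup σ P Q S = S) := fun h' => h (by simp [cupCoeff, h'])
  clear h
  funext x
  unfold cup at *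
  grind (splits := 30)

end Cup
end TemperleyLieb

/-! ### The action of the generators on the diagram basis -/

namespace TemperleyLieb
variable {n : ℕ}

theorem HalfDiagram.involutive (a : HalfDiagram n) : Function.Involutive a.partner :=
  a.partner_partner

/-- The half-diagram that arises by attaching a cap and a cup at the points `p` and `p + 1`. -/
def HalfDiagram.cup (a : HalfDiagram n) (p : ℕ) (hp : p + 1 < n) : HalfDiagram n where
  partner := TemperleyLieb.cup a.partner ⟨p, by omega⟩ ⟨p + 1, hp⟩
  partner_partner := cup_involutive a.involutive (by simp)
  no_crossing i j k l hik hkj hjl hi hk := by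
    have hinv := a.partner_partner
    have nc : ∀ i k, i < k → k < a.partner i → ¬ a.partner i < a.partner k :=
      fun i k h1 h2 h3 => a.no_crossing i _ k _ h1 h2 h3 rfl rfl
    have nt : ∀ i k, i < k → k < a.partner i → a.partner k ≠ k :=
      fun i k h1 h2 => a.no_through_crossing i _ k h1 h2 rfl
    generalize hP : (⟨p, by omega⟩ : Fin n) = P at *
    generalize hQ : (⟨p + 1, hp⟩ : Fin n) = Q at *
    have hPv : P.val = p := by rw [← hP]
    have hQv : Q.val = p + 1 := by rw [← hQ]
    have hPQ : ∀ z, z ≠ P → z ≠ Q → (z < P ∧ z < Q) ∨ (P < z ∧ Q < z) := by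
      intro z h1 h2; omega
    clear hP hQ
    unfold TemperleyLieb.cup at hi hk
    split_ifs at hi hk <;> first | omega | grind (splits := 30)
  no_through_crossing i j k hik hkj hi hk := by
    have hinv := a.partner_partner
    have nc : ∀ i k, i < k → k < a.partner i → ¬ a.partner i < a.partner k :=
      fun i k h1 h2 h3 => a.no_crossing i _ k _ h1 h2 h3 rfl rfl
    have nt : ∀ i k, i < k → k < a.partner i → a.partner k ≠ k :=
      fun i k h1 h2 => a.no_through_crossing i _ k h1 h2 rfl
    generalize hP : (⟨p, by omega⟩ : Fin n) = P at *
    generalize hQ : (⟨p + 1, hp⟩ : Fin n) = Q at *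
    have hPv : P.val = p := by rw [← hP]
    have hQv : Q.val = p + 1 := by rw [← hQ]
    have hPQ : ∀ z, z ≠ P → z ≠ Q → (z < P ∧ z < Q) ∨ (P < z ∧ Q < z) := by
      intro z h1 h2; omega
    clear hP hQ
    unfold TemperleyLieb.cup at hi hk
    split_ifs at hi hk <;> first | omega | grind (splits := 30)

/-- Non-reachability is always shown in this way, by a labelling constant along edges. -/
theorem reachable_imp_eq {V X : Type*} {G : SimpleGraph V} {L : V → X}
    (h : ∀ x y, G.Adj x y → L x = L y) {x y : V} (hr : G.Reachable x y) : L x = L y := by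
  obtain ⟨w⟩ := hr
  induction w with
  | nil => rfl
  | cons hadj _ ih => exact (h _ _ hadj).trans ih

theorem IsConcat.unique {d : Diagram n} {a b b' : HalfDiagram n} (h : IsConcat d a b)
    (h' : IsConcat d a b') : b = b' := by
  ext1
  funext i
  by_cases hi : b.partner i = i
  · by_contra hne
    have h1 : i ≠ b'.partner i := fun h => hne (hi.trans h)
    exact h1 (hi.symm.trans ((h i _ h1).2 ((h' i _ h1).1 rfl)))
  · exact ((h' i _ (Ne.symm hi)).2 ((h i _ (Ne.symm hi)).1 rfl)).symm

theorem act_xi_of_throughJoined (q : ℝ) {d : Diagram n} {a : HalfDiagram n}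
    (h : ThroughJoined d a) : act q d (xi a) = 0 := by
  simp [act, xi, actCoeff, h]

theorem act_xi_of_isConcat (q : ℝ) {d : Diagram n} {a b : HalfDiagram n}
    (h : ¬ ThroughJoined d a) (hb : IsConcat d a b) :
    act q d (xi a) = (q : ℂ) ^ concatLoops d a • xi b := by
  classical
  have : ∀ c, actCoeff q d a c • xi c = if c = b then (q : ℂ) ^ concatLoops d a • xi b else 0 := by
    intro c
    by_cases hc : c = b
    · subst hc; simp [actCoeff, h, hb]
    · have : ¬ IsConcat d a c := fun h' => hc (h'.unique hb)
      simp [hc, actCoeff, this]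
  simp only [act, xi, Finsupp.linearCombination_single, one_smul]
  simp only [xi] at this
  simp [this]

section Gen
variable {p : ℕ} (hp : p + 1 < n) (a : HalfDiagram n)

theorem left_or_right (x : Fin (2 * n)) : (∃ i, x = left i) ∨ ∃ i, x = right i := by
  have := x.isLt
  by_cases h : x.val < n
  · exact .inl ⟨⟨x, h⟩, rfl⟩
  · exact .inr ⟨⟨2 * n - 1 - x, by omega⟩, by simp only [right, Fin.ext_iff]; omega⟩

theorem gen_left (j : Fin n) : (gen n (p + 1) p.succ_pos hp).partner (left j) =
    if j.val = p then left ⟨p + 1, hp⟩ else if j.val = p + 1 then left ⟨p, by omega⟩ else right j := by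
  have := j.isLt
  split_ifs <;> apply Fin.ext <;> simp only [gen, left, right, genPartner] <;> split_ifs <;> omega

theorem gen_right (j : Fin n) : (gen n (p + 1) p.succ_pos hp).partner (right j) =
    if j.val = p then right ⟨p + 1, hp⟩ else if j.val = p + 1 then right ⟨p, by omega⟩
    else left j := by
  have := j.isLt
  split_ifs <;> apply Fin.ext <;> simp only [gen, left, right, genPartner] <;> split_ifs <;> omega

theorem concat_reachable_partner (d : Diagram n) (x : Fin (2 * n)) :
    (concat d a).Reachable x (d.partner x) := by
  by_cases h : x = d.partner x
  · rw [← h]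
  · exact SimpleGraph.Adj.reachable (by simp [concat, SimpleGraph.fromRel_adj, h])

theorem concat_reachable_right (d : Diagram n) (i : Fin n) :
    (concat d a).Reachable (right i) (right (a.partner i)) := by
  by_cases h : right i = right (a.partner i)
  · rw [← h]
  · exact SimpleGraph.Adj.reachable ((SimpleGraph.fromRel_adj _ _ _).2 ⟨h, .inl (.inr ⟨i, rfl, rfl⟩)⟩)

theorem concat_label {X : Type*} {d : Diagram n} {L : Fin (2 * n) → X}
    (h1 : ∀ x, L (d.partner x) = L x) (h2 : ∀ i, L (right (a.partner i)) = L (right i))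
    {x y : Fin (2 * n)} (h : (concat d a).Reachable x y) : L x = L y := by
  refine reachable_imp_eq (fun x y hxy => ?_) h
  have : ∀ x y, (d.partner x = y ∨ ∃ i, x = right i ∧ y = right (a.partner i)) → L x = L y := by
    rintro x y (rfl | ⟨i, rfl, rfl⟩)
    · exact (h1 x).symm
    · exact (h2 i).symm
  obtain ⟨-, h | h⟩ := (SimpleGraph.fromRel_adj _ _ _).1 hxy
  · exact this _ _ h
  · exact (this _ _ h).symm

/-- The common label of the two points of a half-diagram that are joined by a generator. -/
def capLabel (P Q : Fin n) : Sym2 (Fin n) :=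
  if a.partner P ≠ P ∧ a.partner P ≠ Q then s(a.partner P, TemperleyLieb.cup a.partner P Q (a.partner P))
  else if a.partner Q ≠ Q ∧ a.partner Q ≠ P then
    s(a.partner Q, TemperleyLieb.cup a.partner P Q (a.partner Q))
  -- Here the cap closes up to a loop or joins two through-strings. No left point carries the label
  -- `s(P, P)`, because `cup` pairs `P` with `Q`.
  else s(P, P)

/-- A labelling of the points of `e_{p+1}` that is constant on the components of its
concatenation with `a`. -/
def genLabel (x : Fin (2 * n)) : Sym2 (Fin n) :=
  if h : x.val < n then s(⟨x, h⟩, (a.cup p hp).partner ⟨x, h⟩)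
  else if x.val = 2 * n - 1 - p ∨ x.val = 2 * n - 1 - (p + 1) then
    capLabel a ⟨p, by omega⟩ ⟨p + 1, hp⟩
  else s(⟨2 * n - 1 - x, by omega⟩, (a.cup p hp).partner ⟨2 * n - 1 - x, by omega⟩)

theorem genLabel_left (i : Fin n) : genLabel hp a (left i) = s(i, (a.cup p hp).partner i) := by
  simp [genLabel, left]

theorem genLabel_right (i : Fin n) : genLabel hp a (right i) =
    if i.val = p ∨ i.val = p + 1 then capLabel a ⟨p, by omega⟩ ⟨p + 1, hp⟩
    else s(i, (a.cup p hp).partner i) := by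
  have hi := i.isLt
  have e : (⟨2 * n - 1 - (2 * n - 1 - i.val), by omega⟩ : Fin n) = i := by
    simp only [Fin.ext_iff]; omega
  unfold genLabel right
  rw [dif_neg (by simp only; omega)]
  simp only [e]
  exact if_congr (by omega) rfl rfl

/-- Two distinct left points share a label only if `a.cup` pairs them, so this invariance shows that
the concatenation joins nothing beyond what `cup` predicts. -/
theorem genLabel_eq {x y : Fin (2 * n)}
    (h : (concat (gen n (p + 1) p.succ_pos hp) a).Reachable x y) :
    genLabel hp a x = genLabel hp a y := by
  refine concat_label a (fun x => ?_) (fun i => ?_) h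
  · rcases left_or_right x with ⟨i, rfl⟩ | ⟨i, rfl⟩
    · rw [gen_left]
      split_ifs with h1 h2
      · rw [genLabel_left, genLabel_left]
        rw [show i = ⟨p, by omega⟩ from Fin.ext h1]
        simp [HalfDiagram.cup, TemperleyLieb.cup, Sym2.eq_swap]
      · rw [genLabel_left, genLabel_left]
        rw [show i = ⟨p + 1, hp⟩ from Fin.ext h2]
        simp [HalfDiagram.cup, TemperleyLieb.cup, Sym2.eq_swap]
      · rw [genLabel_left, genLabel_right, if_neg (by tauto)]
    · rw [gen_right]
      split_ifs with h1 h2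
      · simp [genLabel_right, h1]
      · simp [genLabel_right, h2]
      · rw [genLabel_left, genLabel_right, if_neg (by tauto)]
  · rw [genLabel_right, genLabel_right]
    have hinv := a.partner_partner
    simp only [HalfDiagram.cup]
    generalize hP : (⟨p, by omega⟩ : Fin n) = P at *
    generalize hQ : (⟨p + 1, hp⟩ : Fin n) = Q at *
    have hPv : ∀ z : Fin n, z.val = p ↔ z = P := by rw [← hP]; simp [Fin.ext_iff]
    have hQv : ∀ z : Fin n, z.val = p + 1 ↔ z = Q := by rw [← hQ]; simp [Fin.ext_iff]
    have hne : P ≠ Q := by rw [← hP, ← hQ]; simp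
    simp only [hPv, hQv]
    clear hP hQ hPv hQv
    unfold capLabel
    have hsym : ∀ x y : Fin n, s(x, y) = s(y, x) := fun _ _ => Sym2.eq_swap
    have hc : ∀ x, TemperleyLieb.cup a.partner P Q x = if x = P then Q else if x = Q then P else
      if a.partner x = P then (if a.partner Q = Q then x else a.partner Q) else
      if a.partner x = Q then (if a.partner P = P then x else a.partner P) else a.partner x :=
      fun _ => rfl
    have := hinv i
    have := hinv P
    have := hinv Q
    simp only [hc]
    clear hc hinv
    grind (splits := 30)

end Gen
end TemperleyLieb

namespace TemperleyLieb
variable {n : ℕ}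

section Gen
variable {p : ℕ} (hp : p + 1 < n) (a : HalfDiagram n)

theorem throughJoined_gen_iff : ThroughJoined (gen n (p + 1) p.succ_pos hp) a ↔
    a.partner ⟨p, by omega⟩ = ⟨p, by omega⟩ ∧ a.partner ⟨p + 1, hp⟩ = ⟨p + 1, hp⟩ := by
  constructor
  · rintro ⟨i, j, hij, hi, hj, hr⟩
    have h := genLabel_eq hp a hr
    rw [genLabel_right, genLabel_right] at h
    have hinv := a.partner_partner
    simp only [HalfDiagram.cup] at h
    generalize hP : (⟨p, by omega⟩ : Fin n) = P at *
    generalize hQ : (⟨p + 1, hp⟩ : Fin n) = Q at *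
    have hPv : ∀ z : Fin n, z.val = p ↔ z = P := by rw [← hP]; simp [Fin.ext_iff]
    have hQv : ∀ z : Fin n, z.val = p + 1 ↔ z = Q := by rw [← hQ]; simp [Fin.ext_iff]
    have hne : P ≠ Q := by rw [← hP, ← hQ]; simp
    simp only [hPv, hQv] at h
    clear hP hQ hPv hQv hr
    unfold capLabel cup at h
    have := hinv P
    have := hinv Q
    have hs : ∀ x y z w : Fin n, s(x, y) = s(z, w) ↔ (x = z ∧ y = w) ∨ (x = w ∧ y = z) := by simp
    grind (splits := 30)
  · rintro ⟨h1, h2⟩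
    refine ⟨⟨p, by omega⟩, ⟨p + 1, hp⟩, by simp, h1, h2, ?_⟩
    have := concat_reachable_partner a (gen n (p + 1) p.succ_pos hp) (right ⟨p, by omega⟩)
    rwa [gen_right, if_pos rfl] at this

theorem gen_reachable_left_right {i : Fin n} (h1 : i.val ≠ p) (h2 : i.val ≠ p + 1) :
    (concat (gen n (p + 1) p.succ_pos hp) a).Reachable (left i) (right i) := by
  have := concat_reachable_partner a (gen n (p + 1) p.succ_pos hp) (left i)
  rwa [gen_left, if_neg h1, if_neg h2] at this

theorem gen_reachable_right : (concat (gen n (p + 1) p.succ_pos hp) a).Reachable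
    (right ⟨p, by omega⟩) (right ⟨p + 1, hp⟩) := by
  have := concat_reachable_partner a (gen n (p + 1) p.succ_pos hp) (right ⟨p, by omega⟩)
  rwa [gen_right, if_pos rfl] at this

theorem gen_reachable_left : (concat (gen n (p + 1) p.succ_pos hp) a).Reachable
    (left ⟨p, by omega⟩) (left ⟨p + 1, hp⟩) := by
  have := concat_reachable_partner a (gen n (p + 1) p.succ_pos hp) (left ⟨p, by omega⟩)
  rwa [gen_left, if_pos rfl] at this

theorem isConcat_gen : IsConcat (gen n (p + 1) p.succ_pos hp) a (a.cup p hp) := by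
  intro i j hij
  constructor
  · intro h
    have hlr := fun i : Fin n => gen_reachable_left_right hp a (i := i)
    have hr := gen_reachable_right hp a
    have hl := gen_reachable_left hp a
    have hrr := concat_reachable_right a (gen n (p + 1) p.succ_pos hp)
    have hinv := a.partner_partner
    simp only [HalfDiagram.cup] at h
    generalize concat (gen n (p + 1) p.succ_pos hp) a = G at *
    generalize hP : (⟨p, by omega⟩ : Fin n) = P at *
    generalize hQ : (⟨p + 1, hp⟩ : Fin n) = Q at *
    have hPv : ∀ z : Fin n, z.val = p ↔ z = P := by rw [← hP]; simp [Fin.ext_iff]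
    have hQv : ∀ z : Fin n, z.val = p + 1 ↔ z = Q := by rw [← hQ]; simp [Fin.ext_iff]
    have hne : P ≠ Q := by rw [← hP, ← hQ]; simp
    simp only [ne_eq, hPv, hQv] at hlr
    clear hP hQ hPv hQv
    unfold cup at h
    split_ifs at h with h1 h2 h3 h4 h5 h6
    · subst h1 h; exact hl
    · subst h2 h; exact hl.symm
    · exact absurd h hij
    · have e1 : j ≠ P := by grind
      have e2 : j ≠ Q := by grind
      exact (hlr i h1 h2).trans ((hrr i).trans ((h3 ▸ hr).trans
        ((hrr Q).trans (h ▸ (hlr j e1 e2).symm))))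
    · exact absurd h hij
    · have e1 : j ≠ P := by grind
      have e2 : j ≠ Q := by grind
      exact (hlr i h1 h2).trans ((hrr i).trans ((h5 ▸ hr.symm).trans
        ((hrr P).trans (h ▸ (hlr j e1 e2).symm))))
    · have e1 : j ≠ P := by grind
      have e2 : j ≠ Q := by grind
      exact (hlr i h1 h2).trans ((hrr i).trans (h ▸ (hlr j e1 e2).symm))
  · intro h
    have h := genLabel_eq hp a h
    rw [genLabel_left, genLabel_left, Sym2.eq_iff] at h
    rcases h with h | h
    · exact absurd h.1 hij
    · exact h.2

/-- Every right point other than `p`, `p + 1` is joined to a left point, so the component of the cap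
is the only candidate for a loop. It is one exactly when `a` pairs the two ends of the cap. -/
theorem concatLoops_gen :
    concatLoops (gen n (p + 1) p.succ_pos hp) a =
      if a.partner ⟨p, by omega⟩ = ⟨p + 1, hp⟩ then 1 else 0 := by
  have hlr := fun i : Fin n => gen_reachable_left_right hp a (i := i)
  have hr := gen_reachable_right hp a
  have hrr := concat_reachable_right a (gen n (p + 1) p.succ_pos hp)
  have hlab := fun i => genLabel_eq hp a (x := left i) (y := right ⟨p, by omega⟩)
  have hlabr := fun i => genLabel_eq hp a (x := right i) (y := right ⟨p, by omega⟩)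
  simp only [genLabel_left, genLabel_right] at hlab hlabr
  have hinv := a.partner_partner
  unfold concatLoops
  simp only [HalfDiagram.cup] at hlab hlabr
  generalize concat (gen n (p + 1) p.succ_pos hp) a = G at *
  generalize hP : (⟨p, by omega⟩ : Fin n) = P at *
  generalize hQ : (⟨p + 1, hp⟩ : Fin n) = Q at *
  have hPv : ∀ z : Fin n, z.val = p ↔ z = P := by rw [← hP]; simp [Fin.ext_iff]
  have hQv : ∀ z : Fin n, z.val = p + 1 ↔ z = Q := by rw [← hQ]; simp [Fin.ext_iff]
  have hne : P ≠ Q := by rw [← hP, ← hQ]; simp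
  simp only [ne_eq, hPv, hQv, true_or, if_true] at hlr hlab hlabr
  clear hPv hQv
  have key : ∀ c : G.ConnectedComponent,
      (∀ i : Fin n, left i ∉ c.supp ∧ (a.partner i = i → right i ∉ c.supp)) →
      c = G.connectedComponentMk (right P) := by
    intro c hc
    induction c using SimpleGraph.ConnectedComponent.ind with
    | _ v =>
      simp only [SimpleGraph.ConnectedComponent.mem_supp_iff, SimpleGraph.ConnectedComponent.eq] at hc ⊢
      rcases left_or_right v with ⟨i, rfl⟩ | ⟨i, rfl⟩
      · exact absurd (SimpleGraph.Reachable.refl _) (hc i).1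
      · by_cases h1 : i = P
        · rw [h1]
        · by_cases h2 : i = Q
          · rw [h2]; exact hr.symm
          · exact absurd (hlr i h1 h2) (hc i).1
  split_ifs with h1
  · rw [Set.ncard_eq_one]
    refine ⟨G.connectedComponentMk (right P), Set.eq_singleton_iff_unique_mem.2 ⟨fun i => ?_, key⟩⟩
    simp only [SimpleGraph.ConnectedComponent.mem_supp_iff, SimpleGraph.ConnectedComponent.eq]
    have hcap : capLabel a P Q = s(P, P) := by
      unfold capLabel; grind
    rw [hcap] at hlab hlabr
    refine ⟨fun hi => ?_, fun hf hi => ?_⟩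
    · have := hlab i hi
      rw [Sym2.eq_iff] at this
      unfold cup at this
      grind
    · have h2 := hlabr i hi
      have := hinv P
      rw [if_neg (by grind), Sym2.eq_iff] at h2
      grind
  · rw [Set.ncard_eq_zero, Set.eq_empty_iff_forall_notMem]
    intro c hc
    obtain rfl := key c hc
    simp only [Set.mem_ofPred_eq, SimpleGraph.ConnectedComponent.mem_supp_iff,
      SimpleGraph.ConnectedComponent.eq] at hc
    have e1 : a.partner P = P := by
      by_contra e1
      exact (hc (a.partner P)).1 ((hlr _ e1 h1).trans (hrr P).symm)
    exact (hc P).2 e1 (SimpleGraph.Reachable.refl _)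

theorem act_gen_xi (q : ℝ) : act q (gen n (p + 1) p.succ_pos hp) (xi a) =
    (cupCoeff q a.partner ⟨p, by omega⟩ ⟨p + 1, hp⟩ : ℂ) • xi (a.cup p hp) := by
  unfold cupCoeff
  split_ifs with h1 h2
  · rw [act_xi_of_throughJoined q ((throughJoined_gen_iff hp a).2 h1)]
    simp
  · rw [act_xi_of_isConcat q ((throughJoined_gen_iff hp a).not.2 h1) (isConcat_gen hp a),
      concatLoops_gen hp a, if_pos h2, pow_one]
  · rw [act_xi_of_isConcat q ((throughJoined_gen_iff hp a).not.2 h1) (isConcat_gen hp a),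
      concatLoops_gen hp a, if_neg h2, pow_zero]
    simp

end Gen
end TemperleyLieb

/-! ### Weights of glued pairings and self-adjointness of the generators -/

namespace TemperleyLieb

section MarkedWeight
variable {V W ι κ ι' κ' : Type*}

open Classical in
/-- The weight of a finite set of points with an equivalence relation and two families of marked
points: zero if a class contains two marks of one family, and otherwise `q` to the number of
classes without marks. -/
noncomputable def markedWeight (q : ℝ) (r : Setoid V) (f : ι → V) (g : κ → V) : ℂ :=
  if (∃ i j, i ≠ j ∧ r (f i) (f j)) ∨ ∃ i j, i ≠ j ∧ r (g i) (g j) then 0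
  else (q : ℂ) ^ Set.ncard {c : Quotient r | (∀ i, ⟦f i⟧ ≠ c) ∧ ∀ i, ⟦g i⟧ ≠ c}

theorem markedWeight_swap (q : ℝ) (r : Setoid V) (f : ι → V) (g : κ → V) :
    markedWeight q r f g = markedWeight q r g f := by
  unfold markedWeight
  split_ifs with h1 h2 h2
  · rfl
  · exact absurd h1.symm h2
  · exact absurd h2.symm h1
  · exact congrArg _ (congrArg Set.ncard (Set.ext fun c => and_comm))

theorem joined_iff {r : Setoid V} {r' : Setoid W} {F : V → W}
    (hF : ∀ x y, r x y ↔ r' (F x) (F y)) {f : ι → V} {f' : ι' → W} (e : ι ≃ ι')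
    (he : ∀ i, r' (F (f i)) (f' (e i))) :
    (∃ i j, i ≠ j ∧ r (f i) (f j)) ↔ ∃ i j, i ≠ j ∧ r' (f' i) (f' j) := by
  constructor
  · rintro ⟨i, j, hij, h⟩
    exact ⟨e i, e j, e.injective.ne hij,
      r'.trans (r'.symm (he i)) (r'.trans ((hF _ _).1 h) (he j))⟩
  · rintro ⟨i, j, hij, h⟩
    refine ⟨e.symm i, e.symm j, e.symm.injective.ne hij, (hF _ _).2 ?_⟩
    have h1 := he (e.symm i)
    have h2 := he (e.symm j)
    simp only [Equiv.apply_symm_apply] at h1 h2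
    exact r'.trans h1 (r'.trans h (r'.symm h2))

theorem unmarked_iff {r : Setoid V} {r' : Setoid W} {F : V → W}
    (hF : ∀ x y, r x y ↔ r' (F x) (F y)) {f : ι → V} {f' : ι' → W} (e : ι ≃ ι')
    (he : ∀ i, r' (F (f i)) (f' (e i))) (x : V) :
    (∀ i, (⟦f i⟧ : Quotient r) ≠ ⟦x⟧) ↔ ∀ i, (⟦f' i⟧ : Quotient r') ≠ ⟦F x⟧ := by
  rw [← e.forall_congr_right]
  refine forall_congr' fun i => not_congr ?_
  rw [Quotient.eq, Quotient.eq, show r (f i) x ↔ _ from hF _ _]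
  exact ⟨fun h => r'.trans (r'.symm (he i)) h, fun h => r'.trans (he i) h⟩

/-- The hypotheses make `F` a bijection on classes; marks need only correspond up to equivalence. -/
theorem markedWeight_congr (q : ℝ) {r : Setoid V} {r' : Setoid W} (F : V → W)
    (hF : ∀ x y, r x y ↔ r' (F x) (F y)) (hsurj : ∀ y, ∃ x, r' (F x) y)
    {f : ι → V} {f' : ι' → W} {g : κ → V} {g' : κ' → W} (e : ι ≃ ι') (e' : κ ≃ κ')
    (he : ∀ i, r' (F (f i)) (f' (e i))) (he' : ∀ i, r' (F (g i)) (g' (e' i))) :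
    markedWeight q r f g = markedWeight q r' f' g' := by
  unfold markedWeight
  rw [joined_iff hF e he, joined_iff hF e' he']
  congr 2
  have : {c : Quotient r' | (∀ i, ⟦f' i⟧ ≠ c) ∧ ∀ i, ⟦g' i⟧ ≠ c} =
      Quotient.map F (fun x y h => (hF x y).1 h) ''
        {c : Quotient r | (∀ i, ⟦f i⟧ ≠ c) ∧ ∀ i, ⟦g i⟧ ≠ c} := by
    ext c
    induction c using Quotient.inductionOn with
    | _ y =>
      obtain ⟨x, hx⟩ := hsurj y
      rw [← (Quotient.sound hx : (⟦F x⟧ : Quotient r') = ⟦y⟧)]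
      constructor
      · rintro ⟨h1, h2⟩
        exact ⟨⟦x⟧, ⟨(unmarked_iff hF e he x).2 h1, (unmarked_iff hF e' he' x).2 h2⟩, rfl⟩
      · rintro ⟨c, hc, hcx⟩
        induction c using Quotient.inductionOn with
        | _ z =>
          rw [← hcx]
          exact ⟨(unmarked_iff hF e he z).1 hc.1, (unmarked_iff hF e' he' z).1 hc.2⟩
  rw [this, Set.ncard_image_of_injective]
  intro c d
  induction c, d using Quotient.inductionOn₂ with
  | _ x y => exact fun h => Quotient.sound ((hF x y).2 (Quotient.exact h))

/-- The class of `w` is the only one missed by `F`, and it carries no mark: one additional loop. -/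
theorem markedWeight_of_isolated [Finite W] (q : ℝ) {r : Setoid V} {r' : Setoid W} (F : V → W)
    (hF : ∀ x y, r x y ↔ r' (F x) (F y)) (w : W) (hw : ∀ x, ¬ r' (F x) w)
    (hsurj : ∀ y, r' w y ∨ ∃ x, r' (F x) y)
    {f : ι → V} {f' : ι' → W} {g : κ → V} {g' : κ' → W} (e : ι ≃ ι') (e' : κ ≃ κ')
    (he : ∀ i, r' (F (f i)) (f' (e i))) (he' : ∀ i, r' (F (g i)) (g' (e' i))) :
    markedWeight q r' f' g' = q * markedWeight q r f g := by
  unfold markedWeight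
  rw [joined_iff hF e he, joined_iff hF e' he', mul_ite, mul_zero, ← pow_succ']
  congr 2
  have : {c : Quotient r' | (∀ i, ⟦f' i⟧ ≠ c) ∧ ∀ i, ⟦g' i⟧ ≠ c} = insert ⟦w⟧
      (Quotient.map F (fun x y h => (hF x y).1 h) ''
        {c : Quotient r | (∀ i, ⟦f i⟧ ≠ c) ∧ ∀ i, ⟦g i⟧ ≠ c}) := by
    ext c
    induction c using Quotient.inductionOn with
    | _ y =>
      rcases hsurj y with hy | ⟨x, hx⟩
      · rw [← (Quotient.sound hy : (⟦w⟧ : Quotient r') = ⟦y⟧)]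
        refine iff_of_true ⟨fun i h => ?_, fun i h => ?_⟩ (Set.mem_insert _ _)
        · have h1 := he (e.symm i)
          rw [Equiv.apply_symm_apply] at h1
          exact hw _ (r'.trans h1 (Quotient.exact h))
        · have h1 := he' (e'.symm i)
          rw [Equiv.apply_symm_apply] at h1
          exact hw _ (r'.trans h1 (Quotient.exact h))
      rw [← (Quotient.sound hx : (⟦F x⟧ : Quotient r') = ⟦y⟧)]
      constructor
      · rintro ⟨h1, h2⟩
        exact .inr ⟨⟦x⟧, ⟨(unmarked_iff hF e he x).2 h1, (unmarked_iff hF e' he' x).2 h2⟩, rfl⟩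
      · rintro (h | ⟨c, hc, hcx⟩)
        · exact absurd (Quotient.exact h) (hw x)
        induction c using Quotient.inductionOn with
        | _ z =>
          rw [← hcx]
          exact ⟨(unmarked_iff hF e he z).1 hc.1, (unmarked_iff hF e' he' z).1 hc.2⟩
  rw [this, Set.ncard_insert_of_notMem, Set.ncard_image_of_injective]
  · intro c d
    induction c, d using Quotient.inductionOn₂ with
    | _ x y => exact fun h => Quotient.sound ((hF x y).2 (Quotient.exact h))
  · rintro ⟨c, -, hc⟩
    induction c using Quotient.inductionOn with
    | _ z => exact hw z (Quotient.exact hc)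

end MarkedWeight

section Sandwich
variable {V : Type*}

/-- The graph in which each point is joined to its images under `σ` and `τ`. -/
def pairingGraph (σ τ : V → V) : SimpleGraph V := SimpleGraph.fromRel fun x y => σ x = y ∨ τ x = y

theorem pairingGraph_left (σ τ : V → V) (x : V) : (pairingGraph σ τ).Reachable x (σ x) := by
  by_cases h : x = σ x
  · rw [← h]
  · exact SimpleGraph.Adj.reachable ((SimpleGraph.fromRel_adj _ _ _).2 ⟨h, .inl (.inl rfl)⟩)

theorem pairingGraph_right (σ τ : V → V) (x : V) : (pairingGraph σ τ).Reachable x (τ x) := by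
  by_cases h : x = τ x
  · rw [← h]
  · exact SimpleGraph.Adj.reachable ((SimpleGraph.fromRel_adj _ _ _).2 ⟨h, .inl (.inr rfl)⟩)

theorem pairingGraph_label {X : Type*} {σ τ : V → V} {L : V → X} (h1 : ∀ x, L (σ x) = L x)
    (h2 : ∀ x, L (τ x) = L x) {x y : V} (h : (pairingGraph σ τ).Reachable x y) : L x = L y := by
  refine reachable_imp_eq (fun x y hxy => ?_) h
  obtain ⟨-, (rfl | rfl) | (rfl | rfl)⟩ := (SimpleGraph.fromRel_adj _ _ _).1 hxy
  · exact (h1 _).symm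
  · exact (h2 _).symm
  · exact h1 _
  · exact h2 _

/-- The weight of the pairings `σ` and `τ` glued along their points. -/
noncomputable def pairingWeight (q : ℝ) (σ τ : V → V) : ℂ :=
  markedWeight q (pairingGraph σ τ).reachableSetoid
    (Subtype.val : {x // σ x = x} → V) (Subtype.val : {x // τ x = x} → V)

theorem pairingWeight_comm (q : ℝ) (σ τ : V → V) : pairingWeight q σ τ = pairingWeight q τ σ := by
  have : pairingGraph σ τ = pairingGraph τ σ := by simp only [pairingGraph, or_comm]
  rw [pairingWeight, pairingWeight, this, markedWeight_swap]

theorem gram_eq_pairingWeight (q : ℝ) {n : ℕ} (a b : HalfDiagram n) :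
    gram q a b = pairingWeight q a.partner b.partner := by
  unfold gram pairingWeight markedWeight
  have h1 : SameSideJoined a b ↔
      (∃ i j : {x // a.partner x = x}, i ≠ j ∧
        (pairingGraph a.partner b.partner).reachableSetoid i.val j.val) ∨
      ∃ i j : {x // b.partner x = x}, i ≠ j ∧
        (pairingGraph a.partner b.partner).reachableSetoid i.val j.val := by
    constructor
    · rintro ⟨i, j, hij, hr, h | h⟩
      · exact .inl ⟨⟨i, h.1⟩, ⟨j, h.2⟩, by simpa using hij, hr⟩
      · exact .inr ⟨⟨i, h.1⟩, ⟨j, h.2⟩, by simpa using hij, hr⟩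
    · rintro (⟨i, j, hij, hr⟩ | ⟨i, j, hij, hr⟩)
      · exact ⟨i, j, Subtype.coe_injective.ne hij, hr, .inl ⟨i.2, j.2⟩⟩
      · exact ⟨i, j, Subtype.coe_injective.ne hij, hr, .inr ⟨i.2, j.2⟩⟩
  split_ifs with h2 h3 h3
  · rfl
  · exact absurd (h1.1 h2) h3
  · exact absurd (h1.2 h3) h2
  refine congrArg _ (congrArg Set.ncard (Set.ext fun c => ?_))
  simp only [Set.mem_ofPred_eq]
  constructor
  · intro h
    exact ⟨fun i hi => (h i hi).1 i.2, fun i hi => (h i hi).2 i.2⟩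
  · rintro ⟨h2, h3⟩ i hi
    exact ⟨fun h => h2 ⟨i, h⟩ hi, fun h => h3 ⟨i, h⟩ hi⟩

variable [DecidableEq V]

/-- The map that identifies `A` with `B`. -/
def collapse (A B x : V) : V := if x = A then B else x

/-- The pairings `σ` and `τ` glued to the two sides of a generator at `P` and `Q`. The points `P`
and `Q` of `σ` are collapsed to `P`, and those of `τ` to `Q`. -/
def sandwichGraph (P Q : V) (σ τ : V → V) : SimpleGraph V :=
  SimpleGraph.fromRel fun x y =>
    (∃ u, x = collapse Q P u ∧ y = collapse Q P (σ u)) ∨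
      ∃ u, x = collapse P Q u ∧ y = collapse P Q (τ u)

/-- The weight of the pairings `σ` and `τ` glued to the two sides of a generator. -/
noncomputable def sandwichWeight (q : ℝ) (P Q : V) (σ τ : V → V) : ℂ :=
  markedWeight q (sandwichGraph P Q σ τ).reachableSetoid
    (fun x : {x // σ x = x} => collapse Q P x.val) (fun x : {x // τ x = x} => collapse P Q x.val)

theorem sandwichWeight_comm (q : ℝ) (P Q : V) (σ τ : V → V) :
    sandwichWeight q P Q σ τ = sandwichWeight q Q P τ σ := by
  have : sandwichGraph P Q σ τ = sandwichGraph Q P τ σ := by simp only [sandwichGraph, or_comm]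
  rw [sandwichWeight, sandwichWeight, this, markedWeight_swap]

theorem sandwichGraph_left (P Q : V) (σ τ : V → V) (u : V) :
    (sandwichGraph P Q σ τ).Reachable (collapse Q P u) (collapse Q P (σ u)) := by
  by_cases h : collapse Q P u = collapse Q P (σ u)
  · rw [← h]
  · exact SimpleGraph.Adj.reachable
      ((SimpleGraph.fromRel_adj _ _ _).2 ⟨h, .inl (.inl ⟨u, rfl, rfl⟩)⟩)

theorem sandwichGraph_right (P Q : V) (σ τ : V → V) (u : V) :
    (sandwichGraph P Q σ τ).Reachable (collapse P Q u) (collapse P Q (τ u)) := by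
  by_cases h : collapse P Q u = collapse P Q (τ u)
  · rw [← h]
  · exact SimpleGraph.Adj.reachable
      ((SimpleGraph.fromRel_adj _ _ _).2 ⟨h, .inl (.inr ⟨u, rfl, rfl⟩)⟩)

theorem sandwichGraph_label {X : Type*} {P Q : V} {σ τ : V → V} {L : V → X}
    (h1 : ∀ u, L (collapse Q P (σ u)) = L (collapse Q P u))
    (h2 : ∀ u, L (collapse P Q (τ u)) = L (collapse P Q u)) {x y : V}
    (h : (sandwichGraph P Q σ τ).Reachable x y) : L x = L y := by
  refine reachable_imp_eq (fun x y hxy => ?_) h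
  obtain ⟨-, (⟨u, rfl, rfl⟩ | ⟨u, rfl, rfl⟩) | (⟨u, rfl, rfl⟩ | ⟨u, rfl, rfl⟩)⟩ :=
    (SimpleGraph.fromRel_adj _ _ _).1 hxy
  · exact (h1 _).symm
  · exact (h2 _).symm
  · exact h1 _
  · exact h2 _

/-- The marks at `P` and `Q` both collapse to the vertex `P`. -/
theorem sandwichWeight_of_fixed (q : ℝ) {P Q : V} (hPQ : P ≠ Q) {σ : V → V} (τ : V → V)
    (h1 : σ P = P) (h2 : σ Q = Q) : sandwichWeight q P Q σ τ = 0 := by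
  refine if_pos (.inl ⟨⟨P, h1⟩, ⟨Q, h2⟩, by simpa using hPQ, ?_⟩)
  simp only [collapse, hPQ, if_true, if_false]
  exact SimpleGraph.Reachable.refl _

/-- The arch of `σ` closes the cap to a loop, leaving the vertex `P` isolated. The other side of the
generator then restores the arch from `P` to `Q`, now represented by the single vertex `Q`. -/
theorem sandwichWeight_of_paired [Finite V] (q : ℝ) {P Q : V} (hPQ : P ≠ Q) {σ τ : V → V}
    (hσ : Function.Involutive σ) (h : σ P = Q) :
    sandwichWeight q P Q σ τ = q * pairingWeight q σ τ := by
  have hQP : σ Q = P := by rw [← h, hσ]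
  set G := pairingGraph σ τ with hG
  have hc : ∀ x, G.connectedComponentMk (collapse P Q x) = G.connectedComponentMk x := by
    intro x
    unfold collapse
    split_ifs with hx
    · subst hx
      rw [← h]
      exact SimpleGraph.ConnectedComponent.sound (pairingGraph_left σ τ x).symm
    · rfl
  -- The label `none` isolates `P`; elsewhere the label is the component in the glued graph of `σ`
  -- and `τ`.
  have hl : ∀ x y, (sandwichGraph P Q σ τ).Reachable x y →
      (if x = P then none else some (G.connectedComponentMk x)) =
      (if y = P then none else some (G.connectedComponentMk y)) := by
    intro x y hxy
    refine sandwichGraph_label (L := fun x => if x = P then none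
      else some (G.connectedComponentMk x)) (fun u => ?_) (fun u => ?_) hxy
    · have h1 := SimpleGraph.ConnectedComponent.sound (pairingGraph_left σ τ u)
      have h2 := hσ u
      simp only [collapse]
      grind
    · have h1 := SimpleGraph.ConnectedComponent.sound (pairingGraph_right σ τ u)
      have h2 : ∀ x, collapse P Q x ≠ P := fun x => by unfold collapse; grind
      simp only [if_neg (h2 _), hc]
      rw [h1]
  have hne : ∀ x, collapse P Q x ≠ P := fun x => by unfold collapse; grind
  refine markedWeight_of_isolated q (collapse P Q) (fun x y => ⟨fun hr => ?_, fun hr => ?_⟩) P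
    (fun x hx => ?_) (fun y => ?_) (.refl _) (.refl _) (fun i => ?_) (fun i => SimpleGraph.Reachable.refl _)
  · refine SimpleGraph.ConnectedComponent.exact (pairingGraph_label
      (L := fun x => (sandwichGraph P Q σ τ).connectedComponentMk (collapse P Q x))
      (fun u => ?_) (fun u => ?_) hr)
    · have h1 := SimpleGraph.ConnectedComponent.sound (sandwichGraph_left P Q σ τ u)
      have h2 := hσ u
      simp only [collapse] at h1 ⊢
      grind
    · exact (SimpleGraph.ConnectedComponent.sound (sandwichGraph_right P Q σ τ u)).symm
  · have h1 := hl _ _ hr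
    rw [if_neg (hne _), if_neg (hne _), hc, hc] at h1
    exact SimpleGraph.ConnectedComponent.exact (Option.some_injective _ h1)
  · have h1 := hl _ _ hx
    rw [if_neg (hne _), if_pos rfl] at h1
    cases h1
  · by_cases hy : y = P
    · subst hy; exact .inl (SimpleGraph.Reachable.refl _)
    · exact .inr ⟨y, by simp only [collapse, if_neg hy]; exact SimpleGraph.Reachable.refl _⟩
  · have h1 := i.2
    have : collapse P Q i.val = collapse Q P i.val := by unfold collapse; grind
    simp only [this, Equiv.refl_apply]
    exact SimpleGraph.Reachable.refl _

theorem sandwichWeight_of_generic (q : ℝ) {P Q : V} (hPQ : P ≠ Q) {σ τ : V → V}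
    (hσ : Function.Involutive σ) (h : ¬ (σ P = P ∧ σ Q = Q)) (h' : σ P ≠ Q) :
    sandwichWeight q P Q σ τ = pairingWeight q (cup σ P Q) τ := by
  have hσσ : ∀ x, σ (σ x) = x := hσ
  -- `z` is an outside point to which the collapsed vertex `P` is joined by `σ`; it stands in for
  -- `P` when components are compared.
  obtain ⟨z, hz⟩ : ∃ z, z = if σ P = P then σ Q else σ P := ⟨_, rfl⟩
  -- If one of `P`, `Q` is a through-string of `σ`, then in `cup σ P Q` the outside partner of the
  -- other one carries it instead. `π` moves that mark back.
  obtain ⟨π, hπ⟩ : ∃ π : Equiv.Perm V, π = if σ P = P then Equiv.swap P (σ Q) else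
    if σ Q = Q then Equiv.swap Q (σ P) else Equiv.refl V := ⟨_, rfl⟩
  set G := pairingGraph (cup σ P Q) τ
  set S := sandwichGraph P Q σ τ
  have hs := fun u => SimpleGraph.ConnectedComponent.sound (sandwichGraph_left P Q σ τ u)
  have hs' := fun u => SimpleGraph.ConnectedComponent.sound (sandwichGraph_right P Q σ τ u)
  have hp := fun u => SimpleGraph.ConnectedComponent.sound (pairingGraph_left (cup σ P Q) τ u)
  have hp' := fun u => SimpleGraph.ConnectedComponent.sound (pairingGraph_right (cup σ P Q) τ u)
  have hG : ∀ x, G.connectedComponentMk (if collapse P Q x = P then z else collapse P Q x) =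
      G.connectedComponentMk x := by
    intro x
    have := hp P
    simp only [cup, collapse] at this ⊢
    grind
  have hS : ∀ x y, S.Reachable x y → G.connectedComponentMk (if x = P then z else x) =
      G.connectedComponentMk (if y = P then z else y) := by
    intro x y hxy
    refine sandwichGraph_label (L := fun x => G.connectedComponentMk (if x = P then z else x))
      (fun u => ?_) (fun u => ?_) hxy
    · have h1 := hp u
      have h2 := hp (σ u)
      have h3 := hp (σ P)
      have h4 := hp (σ Q)
      have := hσσ u
      have := hσσ P
      have := hσσ Q
      simp only [cup, collapse] at h1 h2 h3 h4 ⊢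
      grind (splits := 30)
    · simp only [hG]
      exact (hp' u).symm
  symm
  refine markedWeight_congr q (collapse P Q) (fun x y => ⟨fun hr => ?_, fun hr => ?_⟩)
    (fun y => ?_) (π.subtypeEquiv fun x => ?_) (.refl _) (fun ⟨x, hi⟩ => ?_) (fun i => SimpleGraph.Reachable.refl _)
  · refine SimpleGraph.ConnectedComponent.exact (pairingGraph_label
      (L := fun x => S.connectedComponentMk (collapse P Q x)) (fun u => ?_) (fun u => ?_) hr)
    · have h1 := hs u
      have h3 := hs P
      have h4 := hs Q
      have := hσσ u
      have := hσσ P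
      have := hσσ Q
      simp only [cup, collapse] at h1 h3 h4 ⊢
      grind (splits := 30)
    · exact (hs' u).symm
  · have h1 := hS _ _ hr
    rw [hG, hG] at h1
    exact SimpleGraph.ConnectedComponent.exact h1
  · by_cases hy : y = P
    · refine ⟨z, SimpleGraph.ConnectedComponent.exact ?_⟩
      have h3 := hs P
      have h4 := hs Q
      have := hσσ P
      have := hσσ Q
      simp only [collapse] at h3 h4 ⊢
      grind
    · exact ⟨y, by simp only [collapse, if_neg hy]; exact SimpleGraph.Reachable.refl _⟩
  · have := hσσ x
    have := hσσ P
    have := hσσ Q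
    simp only [cup, hπ]
    split_ifs <;> simp only [Equiv.swap_apply_def, Equiv.refl_apply] <;> grind (splits := 30)
  · refine SimpleGraph.ConnectedComponent.exact ?_
    have h3 := hs P
    have h4 := hs Q
    have h1 := hs x
    have := hσσ x
    have := hσσ P
    have := hσσ Q
    simp only [Equiv.subtypeEquiv_apply]
    simp only [cup, collapse, hπ] at hi h1 h3 h4 ⊢
    split_ifs <;> (try simp only [Equiv.swap_apply_def, Equiv.refl_apply]) <;> grind (splits := 30)

theorem cupCoeff_mul_pairingWeight [Finite V] (q : ℝ) {P Q : V} (hPQ : P ≠ Q) {σ τ : V → V}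
    (hσ : Function.Involutive σ) :
    cupCoeff q σ P Q * pairingWeight q (cup σ P Q) τ = sandwichWeight q P Q σ τ := by
  unfold cupCoeff
  split_ifs with h1 h2
  · rw [sandwichWeight_of_fixed q hPQ τ h1.1 h1.2]
    simp
  · rw [sandwichWeight_of_paired q hPQ hσ h2, cup_eq_self hσ h2]
  · rw [sandwichWeight_of_generic q hPQ hσ h1 h2]
    simp

/-- Attaching a generator is self-adjoint. -/
theorem cupCoeff_mul_pairingWeight_comm [Finite V] (q : ℝ) {P Q : V} (hPQ : P ≠ Q) {σ τ : V → V}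
    (hσ : Function.Involutive σ) (hτ : Function.Involutive τ) :
    cupCoeff q σ P Q * pairingWeight q (cup σ P Q) τ =
      cupCoeff q τ P Q * pairingWeight q σ (cup τ P Q) := by
  -- The right-hand side is the same sandwich seen from the side of `τ`, with `P` and `Q` exchanged.
  rw [cupCoeff_mul_pairingWeight q hPQ hσ, pairingWeight_comm q σ, cup_comm τ P Q hτ,
    cupCoeff_comm q hτ, cupCoeff_mul_pairingWeight q hPQ.symm hτ, sandwichWeight_comm]

end Sandwich
end TemperleyLieb

/-! ### The sesquilinear form and the Temperley–Lieb relations -/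

namespace TemperleyLieb
variable {n : ℕ}

section Form
variable (q : ℝ)

theorem form_add_left (v v' w : U n) : form q (v + v') w = form q v w + form q v' w := by
  simp only [form, Finsupp.add_apply, add_mul, Finset.sum_add_distrib]

theorem form_smul_left (c : ℂ) (v w : U n) : form q (c • v) w = c * form q v w := by
  simp only [form, Finsupp.smul_apply, smul_eq_mul, Finset.mul_sum, mul_assoc]

theorem gram_comm (a b : HalfDiagram n) : gram q a b = gram q b a := by
  rw [gram_eq_pairingWeight, gram_eq_pairingWeight, pairingWeight_comm]

theorem conj_gram (a b : HalfDiagram n) : (starRingEnd ℂ) (gram q a b) = gram q a b := by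
  unfold gram
  split_ifs <;> simp

theorem conj_form (v w : U n) : (starRingEnd ℂ) (form q v w) = form q w v := by
  simp only [form, map_sum, map_mul, Complex.conj_conj, conj_gram]
  rw [Finset.sum_comm]
  refine Finset.sum_congr rfl fun a _ => Finset.sum_congr rfl fun b _ => ?_
  rw [gram_comm]
  ring

theorem form_add_right (v w w' : U n) : form q v (w + w') = form q v w + form q v w' := by
  rw [← conj_form, form_add_left, map_add, conj_form, conj_form]

theorem form_smul_right (c : ℂ) (v w : U n) :
    form q v (c • w) = (starRingEnd ℂ) c * form q v w := by
  rw [← conj_form, form_smul_left, map_mul, conj_form]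

theorem form_zero_left (w : U n) : form q 0 w = 0 := by simp [form]

theorem form_zero_right (v : U n) : form q v 0 = 0 := by simp [form]

theorem form_sub_left (v v' w : U n) : form q (v - v') w = form q v w - form q v' w := by
  rw [sub_eq_add_neg, ← neg_one_smul ℂ v', form_add_left, form_smul_left]; ring

theorem form_xi_xi (a b : HalfDiagram n) : form q (xi a) (xi b) = gram q a b := by
  classical
  simp [form, xi, Finsupp.single_apply]

theorem form_eq_of_xi (T : U n →ₗ[ℂ] U n)
    (h : ∀ a b, form q (T (xi a)) (xi b) = form q (xi a) (T (xi b))) (v w : U n) :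
    form q (T v) w = form q v (T w) := by
  induction v using Finsupp.induction_linear with
  | zero => simp [form_zero_left]
  | add v v' h1 h2 => rw [map_add, form_add_left, form_add_left, h1, h2]
  | single a c =>
    induction w using Finsupp.induction_linear with
    | zero => simp [form_zero_right]
    | add w w' h1 h2 => rw [map_add, form_add_right, form_add_right, h1, h2]
    | single b d =>
      have e : ∀ (a : HalfDiagram n) (c : ℂ), Finsupp.single a c = c • xi a := by simp [xi]
      rw [e, e, map_smul, map_smul, form_smul_left, form_smul_left, form_smul_right,
        form_smul_right, h]

end Form

/-- The operator `e_{p+1}` on `U(n)`, which joins the points with indices `p` and `p + 1`; it is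
zero if there are no such points. -/
noncomputable def E (q : ℝ) (p : ℕ) : U n →ₗ[ℂ] U n :=
  if h : p + 1 < n then act q (gen n (p + 1) p.succ_pos h) else 0

section E
variable (q : ℝ)

theorem E_xi {p : ℕ} (hp : p + 1 < n) (a : HalfDiagram n) : E q p (xi a) =
    (cupCoeff q a.partner ⟨p, by omega⟩ ⟨p + 1, hp⟩ : ℂ) • xi (a.cup p hp) := by
  rw [E, dif_pos hp, act_gen_xi]

theorem form_E (p : ℕ) (v w : U n) : form q (E q p v) w = form q v (E q p w) := by
  by_cases hp : p + 1 < n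
  · refine form_eq_of_xi q _ (fun a b => ?_) v w
    rw [E_xi q hp, E_xi q hp, form_smul_left, form_smul_right, form_xi_xi, form_xi_xi,
      gram_eq_pairingWeight, gram_eq_pairingWeight, Complex.conj_ofReal]
    exact cupCoeff_mul_pairingWeight_comm q (by simp) a.involutive b.involutive
  · simp [E, hp, form_zero_left, form_zero_right]

theorem linearMap_eq_of_xi {S T : U n →ₗ[ℂ] U n} (h : ∀ a, S (xi a) = T (xi a)) : S = T :=
  Finsupp.lhom_ext' fun a => LinearMap.ext_ring (h a)

theorem E_E (p : ℕ) (v : U n) : E q p (E q p v) = (q : ℂ) • E q p v := by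
  by_cases hp : p + 1 < n
  · suffices E q p ∘ₗ E q p = (q : ℂ) • (E q p : U n →ₗ[ℂ] U n) from LinearMap.congr_fun this v
    refine linearMap_eq_of_xi fun a => ?_
    have h1 : (a.cup p hp).cup p hp = a.cup p hp :=
      HalfDiagram.ext (cup_eq_self (a.cup p hp).involutive (by simp [HalfDiagram.cup, cup]))
    have h2 : cupCoeff q (a.cup p hp).partner ⟨p, by omega⟩ ⟨p + 1, hp⟩ = q :=
      cupCoeff_cup q (by simp)
    simp only [LinearMap.comp_apply, LinearMap.smul_apply, E_xi q hp, map_smul, h1, h2]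
    rw [smul_comm]
  · simp [E, hp]

theorem E_E_succ_E {p : ℕ} (hp : p + 2 < n) (v : U n) :
    E q p (E q (p + 1) (E q p v)) = E q p v := by
  suffices E q p ∘ₗ E q (p + 1) ∘ₗ E q p = (E q p : U n →ₗ[ℂ] U n) from LinearMap.congr_fun this v
  refine linearMap_eq_of_xi fun a => ?_
  have h1 : ((a.cup p (by omega)).cup (p + 1) hp).cup p (by omega) = a.cup p (by omega) :=
    HalfDiagram.ext (cup_cup_cup a.involutive (by simp) (by simp) (by simp; omega))
  obtain ⟨h2, h3⟩ := cupCoeff_cup_adjacent q a.involutive (P := ⟨p, by omega⟩)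
    (Q := ⟨p + 1, by omega⟩) (R := ⟨p + 2, by omega⟩) (by simp) (by simp) (by simp)
  simp only [LinearMap.comp_apply, E_xi q (show p + 1 < n by omega), E_xi q hp, map_smul, h1]
  erw [h2, h3]
  simp

theorem E_succ_E_E_succ {p : ℕ} (hp : p + 2 < n) (v : U n) :
    E q (p + 1) (E q p (E q (p + 1) v)) = E q (p + 1) v := by
  suffices E q (p + 1) ∘ₗ E q p ∘ₗ E q (p + 1) = (E q (p + 1) : U n →ₗ[ℂ] U n) from
    LinearMap.congr_fun this v
  refine linearMap_eq_of_xi fun a => ?_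
  have hQ := (a.cup (p + 1) hp).involutive
  -- `cup` is symmetric in its two points, so this relation is the mirror image of the previous one,
  -- with `P`, `Q`, `R` in decreasing order.
  have e1 : ∀ b : HalfDiagram n, cup b.partner ⟨p, by omega⟩ ⟨p + 1, by omega⟩ =
      cup b.partner ⟨p + 1, by omega⟩ ⟨p, by omega⟩ := fun b => cup_comm _ _ _ b.involutive
  have e2 : ∀ b : HalfDiagram n, cup b.partner ⟨p + 1, by omega⟩ ⟨p + 2, hp⟩ =
      cup b.partner ⟨p + 2, hp⟩ ⟨p + 1, by omega⟩ := fun b => cup_comm _ _ _ b.involutive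
  have h1 : ((a.cup (p + 1) hp).cup p (by omega)).cup (p + 1) hp = a.cup (p + 1) hp := by
    refine HalfDiagram.ext ((e2 _).trans ?_)
    have := cup_cup_cup a.involutive (P := ⟨p + 2, hp⟩) (Q := ⟨p + 1, by omega⟩)
      (R := ⟨p, by omega⟩) (by simp) (by simp) (by simp)
    have h3 := e1 (a.cup (p + 1) hp)
    simp only [HalfDiagram.cup] at h3 ⊢
    rw [h3, e2 a, this]
  obtain ⟨h2, h3⟩ := cupCoeff_cup_adjacent q a.involutive (P := ⟨p + 2, hp⟩)
    (Q := ⟨p + 1, by omega⟩) (R := ⟨p, by omega⟩) (by simp) (by simp) (by simp)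
  have h2' : cupCoeff q (a.cup (p + 1) hp).partner ⟨p, by omega⟩ ⟨p + 1, by omega⟩ = 1 := by
    rw [cupCoeff_comm q hQ, ← h2, ← e2]
    rfl
  have h3' : cupCoeff q ((a.cup (p + 1) hp).cup p (by omega)).partner ⟨p + 1, by omega⟩
      ⟨p + 2, hp⟩ = 1 := by
    have h4 := e1 (a.cup (p + 1) hp)
    rw [cupCoeff_comm q (HalfDiagram.involutive _), ← h3, ← e2]
    simp only [HalfDiagram.cup] at h4 ⊢
    rw [h4]
  simp only [LinearMap.comp_apply, E_xi q (show p + 1 < n by omega), E_xi q hp, map_smul, h1, h2',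
    h3']
  simp

theorem E_comm {p r : ℕ} (h : p + 2 ≤ r) (v : U n) :
    E q p (E q r v) = E q r (E q p v) := by
  by_cases hr : r + 1 < n
  · suffices E q p ∘ₗ E q r = (E q r ∘ₗ E q p : U n →ₗ[ℂ] U n) from LinearMap.congr_fun this v
    refine linearMap_eq_of_xi fun a => ?_
    have hp : p + 1 < n := by omega
    have h1 := cupCoeff_mul_comm q a.involutive (P := ⟨p, by omega⟩)
      (Q := ⟨p + 1, hp⟩) (R := ⟨r, by omega⟩) (S := ⟨r + 1, hr⟩) (by simp) (by simp)
      (by simp; omega) (by simp; omega) (by simp; omega) (by simp; omega)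
    have h2 := cup_cup_comm q a.involutive (P := ⟨p, by omega⟩)
      (Q := ⟨p + 1, hp⟩) (R := ⟨r, by omega⟩) (S := ⟨r + 1, hr⟩) (by simp) (by simp)
      (by simp; omega) (by simp; omega) (by simp; omega) (by simp; omega)
    simp only [LinearMap.comp_apply, E_xi q hp, E_xi q hr, map_smul, smul_smul, ← Complex.ofReal_mul]
    rw [show cupCoeff q a.partner ⟨r, by omega⟩ ⟨r + 1, hr⟩ *
      cupCoeff q (a.cup r hr).partner ⟨p, by omega⟩ ⟨p + 1, hp⟩ = _ from h1.symm]
    by_cases h0 : cupCoeff q a.partner ⟨p, by omega⟩ ⟨p + 1, hp⟩ *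
        cupCoeff q (cup a.partner ⟨p, by omega⟩ ⟨p + 1, hp⟩) ⟨r, by omega⟩ ⟨r + 1, hr⟩ = 0
    · rw [show cupCoeff q a.partner ⟨p, by omega⟩ ⟨p + 1, hp⟩ *
        cupCoeff q (a.cup p hp).partner ⟨r, by omega⟩ ⟨r + 1, hr⟩ = 0 from h0, h0]
      simp
    · rw [show (a.cup r hr).cup p hp = (a.cup p hp).cup r hr from HalfDiagram.ext (h2 h0).symm]
      rfl
  · simp [E, hr]

end E

/-! ### Norms of the diagram basis vectors -/

namespace HalfDiagram

theorem glue_self_reachable {a : HalfDiagram n} {x y : Fin n} :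
    (glue a a).Reachable x y ↔ x = y ∨ a.partner x = y := by
  constructor
  · intro h
    have h1 := pairingGraph_label (σ := a.partner) (τ := a.partner)
      (L := fun x => s(x, a.partner x)) (fun x => by simp [a.partner_partner, Sym2.eq_swap])
      (fun x => by simp [a.partner_partner, Sym2.eq_swap]) h
    rw [Sym2.eq_iff] at h1
    exact h1.imp And.left And.right
  · rintro (rfl | rfl)
    · exact SimpleGraph.Reachable.refl _
    · exact pairingGraph_left a.partner a.partner x

/-- Gluing `a` to itself turns each arch into a loop, and each arch is counted by its closing
bracket. -/
theorem gram_self (q : ℝ) (a : HalfDiagram n) :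
    gram q a a = (q : ℂ) ^ (Finset.univ.filter fun k => ¬ a.IsOpening k).card := by
  have h1 : ¬ SameSideJoined a a := by
    rintro ⟨i, j, hij, hr, h⟩
    rcases glue_self_reachable.1 hr with h' | h'
    · exact hij h'
    · rcases h with h | h <;> exact hij (h.1.symm.trans h')
  unfold gram
  rw [if_neg h1, glueLoops]
  congr 1
  have : {c : (glue a a).ConnectedComponent | ∀ i ∈ c.supp, a.partner i ≠ i ∧ a.partner i ≠ i} =
      (glue a a).connectedComponentMk '' (Finset.univ.filter fun k => ¬ a.IsOpening k) := by
    ext c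
    induction c using SimpleGraph.ConnectedComponent.ind with
    | _ v =>
      simp only [Set.mem_ofPred_eq, and_self, Set.mem_image, Finset.coe_filter, Finset.mem_univ,
        true_and, SimpleGraph.ConnectedComponent.mem_supp_iff, SimpleGraph.ConnectedComponent.eq,
        glue_self_reachable, IsOpening, not_le]
      have hv := a.partner_partner v
      constructor
      · intro h
        have := h v (.inl rfl)
        rcases lt_or_gt_of_ne this with h2 | h2
        · exact ⟨v, h2, .inl rfl⟩
        · exact ⟨a.partner v, by rwa [hv], .inr hv⟩
      · rintro ⟨k, hk, h⟩ i hi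
        have := a.partner_partner k
        have := a.partner_partner i
        grind
  rw [this, Set.InjOn.ncard_image, Set.ncard_coe_finset]
  intro x hx y hy hxy
  simp only [Finset.coe_filter, Finset.mem_univ, true_and, Set.mem_ofPred_eq, IsOpening,
    not_le] at hx hy
  have := glue_self_reachable.1 (SimpleGraph.ConnectedComponent.exact hxy)
  have := a.partner_partner x
  grind

end HalfDiagram
end TemperleyLieb

/-! ### The second basis is well defined -/

namespace TemperleyLieb
open HalfDiagram
variable {n : ℕ} {q : ℝ}

namespace HalfDiagram

/-- If `b` arises from `a'` and from `a''` by two different box additions, these commute. -/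
theorem IsBoxAddition.diamond {p r : ℕ} (hpr : p ≠ r) {a a' b : HalfDiagram n}
    (h : IsBoxAddition (p + 1) a b) (h' : IsBoxAddition (r + 1) a' b) :
    (p + 2 ≤ r ∨ r + 2 ≤ p) ∧
      ∃ c, IsBoxAddition (r + 1) c a ∧ IsBoxAddition (p + 1) c a' := by
  have H := isBoxAddition_succ.1 h
  have H' := isBoxAddition_succ.1 h'
  simp only [down_iff] at H H'
  have hd : p + 2 ≤ r ∨ r + 2 ≤ p := by
    have : p + 1 ≠ r := by rintro rfl; tauto
    have : r + 1 ≠ p := by rintro rfl; tauto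
    omega
  refine ⟨hd, ?_⟩
  -- The box at `p + 1` does not change the height at `r + 1`, so `a` has there the height of `b`,
  -- which exceeds that of `a'` by 2.
  obtain ⟨c, hc⟩ := exists_removal (b := a) (p := r) (by grind) (down_iff.2 (by grind)) (by
    have h1 := h.height_eq (r + 1) (by omega)
    have h2 := h'.height_eq (r + 1) (by omega)
    simp only [Nat.add_right_cancel_iff, hpr.symm, if_true, if_false] at h1 h2
    omega)
  refine ⟨c, hc, isBoxAddition_succ.2 ?_⟩
  have Hc := isBoxAddition_succ.1 hc
  simp only [down_iff] at Hc ⊢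
  refine ⟨by grind, by grind, fun k h1 h2 => ?_⟩
  by_cases h3 : k = r
  · grind
  · by_cases h4 : k = r + 1
    · grind
    · grind

theorem IsBoxAddition.size_lt {a b : HalfDiagram n} {i : ℕ} (h : IsBoxAddition i a b) :
    a.size < b.size := by
  obtain ⟨p, rfl⟩ : ∃ p, i = p + 1 := ⟨i - 1, by have := h.isMinimum.1; omega⟩
  rw [h.size_eq]; omega

theorem IsBoxAddition.left_unique {a a' b : HalfDiagram n} {p : ℕ}
    (h : IsBoxAddition (p + 1) a b) (h' : IsBoxAddition (p + 1) a' b) : a = a' := by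
  have H := isBoxAddition_succ.1 h
  have H' := isBoxAddition_succ.1 h'
  simp only [down_iff] at H H'
  exact eq_of_up_iff fun k => by grind

theorem IsBoxAddition.not_isMinimal {a b : HalfDiagram n} {p : ℕ}
    (h : IsBoxAddition (p + 1) a b) : ¬ b.IsMinimal := fun hb => by
  have hd := (isBoxAddition_succ.1 h).2.1.2
  have h1 := isMinimal_iff.1 hb _ hd
  have h2 := h.height_eq (p + 1) hd.lt.le
  simp at h2
  omega

end HalfDiagram

theorem whiteBox_succ {p : ℕ} {a b : HalfDiagram n} {v : U n} (hv : WhiteBox q a v)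
    (h : IsBoxAddition (p + 1) a b) :
    WhiteBox q b (E q p v - (mu q (a.height (p + 1) + 1) : ℂ) • v) := by
  rw [E, dif_pos h.isMinimum.2.1]
  exact .box hv h

theorem WhiteBox.minimal_or_box {b : HalfDiagram n} {v : U n} (h : WhiteBox q b v) :
    b.IsMinimal ∧ v = xi b ∨ ∃ p a w, IsBoxAddition (p + 1) a b ∧ WhiteBox q a w ∧
      v = E q p w - (mu q (a.height (p + 1) + 1) : ℂ) • w := by
  cases h with
  | minimal hb => exact .inl ⟨hb, rfl⟩
  | @box i a _ w hw hab =>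
    obtain ⟨p, rfl⟩ : ∃ p, i = p + 1 := ⟨i - 1, by have := hab.isMinimum.1; omega⟩
    exact .inr ⟨p, a, w, hab, hw, by rw [E, dif_pos hab.isMinimum.2.1]⟩

theorem exists_whiteBox (q : ℝ) (a : HalfDiagram n) : ∃ v, WhiteBox q a v := by
  induction hm : a.size using Nat.strong_induction_on generalizing a with
  | _ m ih =>
    by_cases h : a.IsMinimal
    · exact ⟨_, .minimal h⟩
    · obtain ⟨p, h1, h2, h3⟩ := exists_maximum_of_not_isMinimal h
      obtain ⟨c, hc⟩ := exists_removal h1 h2 h3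
      obtain ⟨v, hv⟩ := ih _ (hm ▸ hc.size_lt) c rfl
      exact ⟨_, whiteBox_succ hv hc⟩

theorem E_comm' {p r : ℕ} (h : p + 2 ≤ r ∨ r + 2 ≤ p) (v : U n) :
    E q p (E q r v) = E q r (E q p v) := by
  rcases h with h | h
  · exact E_comm q h v
  · exact (E_comm q h v).symm

/-- Confluence: two last boxes at different places are at distance at least 2, so both can be
removed (`diamond`). Their generators commute, and neither box changes the height that enters the
other `μ`. -/
theorem WhiteBox.unique {a : HalfDiagram n} {v w : U n} (hv : WhiteBox q a v)
    (hw : WhiteBox q a w) : v = w := by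
  induction hm : a.size using Nat.strong_induction_on generalizing a v w with
  | _ m ih =>
    rcases hv.minimal_or_box with ⟨ha, rfl⟩ | ⟨p, b, v', hb, hv', rfl⟩
    · rcases hw.minimal_or_box with ⟨-, rfl⟩ | ⟨r, c, w', hc, -, -⟩
      · rfl
      · exact absurd ha hc.not_isMinimal
    · rcases hw.minimal_or_box with ⟨ha, -⟩ | ⟨r, c, w', hc, hw', rfl⟩
      · exact absurd ha hb.not_isMinimal
      · by_cases hpr : p = r
        · subst hpr
          obtain rfl := hb.left_unique hc
          rw [ih _ (hm ▸ hb.size_lt) hv' hw' rfl]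
        · obtain ⟨hd, d, hdb, hdc⟩ := hb.diamond hpr hc
          obtain ⟨u, hu⟩ := exists_whiteBox q d
          have e1 := hdb.height_eq (p + 1) (by have := hb.isMinimum.2.1; omega)
          have e2 := hdc.height_eq (r + 1) (by have := hc.isMinimum.2.1; omega)
          rw [if_neg (by omega)] at e1 e2
          rw [ih _ (hm ▸ hb.size_lt) hv' (whiteBox_succ hu hdb) rfl,
            ih _ (hm ▸ hc.size_lt) hw' (whiteBox_succ hu hdc) rfl, e1, e2]
          simp only [map_sub, map_smul, E_comm' hd, add_zero]
          module

theorem whiteBox_xi' (q : ℝ) (a : HalfDiagram n) : WhiteBox q a (xi' q a) := by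
  have h := exists_whiteBox q a
  rw [xi', dif_pos h]
  exact h.choose_spec

theorem xi'_of_isMinimal {a : HalfDiagram n} (h : a.IsMinimal) : xi' q a = xi a :=
  (whiteBox_xi' q a).unique (.minimal h)

theorem xi'_of_isBoxAddition {a b : HalfDiagram n} {p : ℕ} (h : IsBoxAddition (p + 1) a b) :
    xi' q b = E q p (xi' q a) - (mu q (a.height (p + 1) + 1) : ℂ) • xi' q a :=
  (whiteBox_xi' q b).unique (whiteBox_succ (whiteBox_xi' q a) h)

theorem exists_isBoxAddition_of_not_isMinimal {a : HalfDiagram n} (h : ¬ a.IsMinimal) :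
    ∃ p c, IsBoxAddition (p + 1) c a := by
  obtain ⟨p, h1, h2, h3⟩ := exists_maximum_of_not_isMinimal h
  exact ⟨p, exists_removal h1 h2 h3⟩

/-! ### The generators acting on the second basis -/

/-- The hypothesis under which the quotients that define `xi' q a` make sense. -/
def ChebNeZero (q : ℝ) (a : HalfDiagram n) : Prop :=
  ∀ i ∈ a.maxima, ∀ k, k < a.height i → cheb q k ≠ 0

theorem ChebNeZero.ne {a : HalfDiagram n} (h : ChebNeZero q a) {p k : ℕ} (h1 : a.Up p)
    (h2 : a.Down (p + 1)) (hk : k < a.height (p + 1)) : cheb q k ≠ 0 :=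
  h (p + 1) (by simp [maxima, h2.lt, isMaximum_succ, h1, h2]) k hk

/-- A maximum of `a` next to the box is one lower than the new maximum of `b`; all other maxima of
`a` survive in `b` with the same height. -/
theorem ChebNeZero.of_isBoxAddition {a b : HalfDiagram n} {p : ℕ} (hb : ChebNeZero q b)
    (h : IsBoxAddition (p + 1) a b) : ChebNeZero q a := by
  intro i hi k hk
  simp only [maxima, Finset.mem_filter, Finset.mem_range] at hi
  obtain ⟨s, rfl⟩ : ∃ s, i = s + 1 := ⟨i - 1, by have := hi.2.1; omega⟩
  obtain ⟨h1, h2⟩ := isMaximum_succ.1 hi.2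
  obtain ⟨⟨h3, h4⟩, ⟨h5, h6⟩, h7⟩ := isBoxAddition_succ.1 h
  have hp := h.height_eq (p + 1) h4.lt.le
  rw [if_pos rfl] at hp
  by_cases hs1 : s + 1 = p
  · subst hs1
    have := h3.height_succ
    exact hb.ne h5 h6 (by omega)
  by_cases hs2 : s = p + 1
  · subst hs2
    have := h4.height_succ
    exact hb.ne h5 h6 (by omega)
  have hs3 : s ≠ p := by rintro rfl; exact h4.not_down h2
  have hh := h.height_eq (s + 1) hi.1.le
  rw [if_neg (by omega)] at hh
  simp only [down_iff] at h2 h3 h4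
  exact hb.ne (p := s) ((h7 s hs3 hs2).2 h1)
    (down_iff.2 ⟨h2.1, (h7 (s + 1) hs1 (by omega)).not.2 h2.2⟩) (by omega)

/-- The recursion gives `q - μ_h = Δ_{h+1} / Δ_h`, the inverse of `μ_{h+1}`. -/
theorem mu_succ_mul_sub {h : ℕ} (hh : 1 ≤ h) (h1 : cheb q h ≠ 0) (h2 : cheb q (h + 1) ≠ 0) :
    mu q (h + 1) * (q - mu q h) = 1 := by
  obtain ⟨m, rfl⟩ : ∃ m, h = m + 1 := ⟨h - 1, by omega⟩
  have h3 := cheb_add_two q m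
  rw [show m + 1 + 1 = m + 2 from rfl] at h2 ⊢
  simp only [mu, Nat.add_sub_cancel, show m + 2 - 1 = m + 1 from rfl]
  field_simp
  linarith

/-- The last box creates a maximum of height at least 2, so it is neither at this peak nor next to
it. Its generator commutes with `E q p`, and the claim descends to a minimal diagram, where the cap
closes a small arch to a loop. -/
theorem E_xi'_of_height_eq_one {a : HalfDiagram n} {p : ℕ} (h1 : a.Up p) (h2 : a.Down (p + 1))
    (h3 : a.height (p + 1) = 1) : E q p (xi' q a) = (q : ℂ) • xi' q a := by
  induction hm : a.size using Nat.strong_induction_on generalizing a with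
  | _ m ih =>
    by_cases hmin : a.IsMinimal
    · have hP := partner_of_up_down h1 h2
      have hc : a.cup p h2.lt = a := HalfDiagram.ext (cup_eq_self a.involutive hP)
      rw [xi'_of_isMinimal hmin, E_xi q h2.lt, hc, cupCoeff, if_neg, if_pos hP]
      simp [hP]
    · obtain ⟨r, c, hc⟩ := exists_isBoxAddition_of_not_isMinimal hmin
      have hh := hc.height_eq (p + 1) h2.lt.le
      have Hc := isBoxAddition_succ.1 hc
      simp only [down_iff] at Hc h2
      have hd : p + 2 ≤ r ∨ r + 2 ≤ p := by
        have : p ≠ r := by rintro rfl; simp at hh; omega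
        have : p + 1 ≠ r := by rintro rfl; tauto
        have : r + 1 ≠ p := by rintro rfl; tauto
        omega
      rw [if_neg (by omega)] at hh
      have := ih _ (hm ▸ hc.size_lt) (a := c) (by grind) (down_iff.2 (by grind)) (by omega) rfl
      rw [xi'_of_isBoxAddition hc, map_sub, map_smul, E_comm' hd, this, map_smul]
      module

/-- In a minimal half-diagram, all brackets after two consecutive opening ones are
through-strings. -/
theorem partner_eq_self_of_isMinimal {a : HalfDiagram n} (h : a.IsMinimal) {p : ℕ} (h1 : a.Up p)
    (h2 : a.Up (p + 1)) {k : Fin n} (hk : p ≤ k.val) : a.partner k = k := by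
  rw [isMinimal_iff] at h
  have key : ∀ k, p + 2 ≤ k → k ≤ n → 2 ≤ a.height k := by
    intro k hk
    induction k, hk using Nat.le_induction with
    | base =>
      have := h1.height_succ
      have := h2.height_succ
      rw [show p + 2 = p + 1 + 1 from rfl]
      intro; omega
    | succ k hk ih =>
      intro hn
      have ih := ih (by omega)
      rcases a.up_or_down (show k < n by omega) with hu | hd
      · have := hu.height_succ; omega
      · have := h k hd; omega
  have hup : ∀ k : Fin n, p ≤ k.val → a.Up k := by
    intro k hk
    by_cases hk1 : k.val = p
    · rwa [hk1]
    by_cases hk2 : k.val = p + 1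
    · rwa [hk2]
    refine (a.up_or_down k.2).resolve_right fun hd => ?_
    have := h k hd
    have := key k (by omega) k.2.le
    omega
  obtain ⟨_, hk'⟩ := hup k hk
  obtain ⟨_, hk''⟩ := hup (a.partner k) (hk.trans hk')
  have h5 : a.partner k ≤ k := by simpa [IsOpening, a.partner_partner] using hk''
  exact le_antisymm h5 hk'

/-- `e_i` kills `xi' q b` if the path of `b` has a slope at `i`. -/
theorem E_xi'_of_slope (hq : q ≠ 0) {b : HalfDiagram n} (hb : ChebNeZero q b) {p : ℕ}
    (hp : p + 1 < n) (hs : b.Up p ↔ b.Up (p + 1)) : E q p (xi' q b) = 0 := by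
  induction hm : b.size using Nat.strong_induction_on generalizing b p with
  | _ m ih =>
    by_cases hmin : b.IsMinimal
    · rcases b.up_or_down (show p < n by omega) with hu | hd
      · rw [xi'_of_isMinimal hmin, E_xi q hp, cupCoeff, if_pos]
        · simp
        · exact ⟨partner_eq_self_of_isMinimal hmin hu (hs.1 hu) le_rfl,
            partner_eq_self_of_isMinimal hmin hu (hs.1 hu) (Nat.le_succ p)⟩
      · have hd' := down_iff.2 ⟨hp, hs.not.1 hd.not_up⟩
        have h1 := isMinimal_iff.1 hmin _ hd
        have h2 := isMinimal_iff.1 hmin _ hd'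
        have := hd.height_succ
        omega
    · obtain ⟨r, a, ha⟩ := exists_isBoxAddition_of_not_isMinimal hmin
      have Ha := isBoxAddition_succ.1 ha
      have hhb := ha.height_eq (r + 1) Ha.1.2.lt.le
      have hne := fun k => hb.ne (k := k) Ha.2.1.1 Ha.2.1.2
      rw [if_pos rfl] at hhb
      have hd1 := Ha.1.1.height_succ
      have hu1 := Ha.1.2.height_succ
      simp only [down_iff] at Ha
      rw [xi'_of_isBoxAddition ha]
      by_cases hd : p + 2 ≤ r ∨ r + 2 ≤ p
      · have := ih _ (hm ▸ ha.size_lt) (hb.of_isBoxAddition ha) hp (by grind) rfl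
        rw [map_sub, map_smul, E_comm' hd, this]
        simp
      -- The last box touches the slope. Then `a` has a maximum at `p + 1`, one higher than its
      -- minimum at `r + 1`, and `E q p`, `E q r` are adjacent generators.
      · have hpr : p ≠ r := by rintro rfl; tauto
        have hmax : a.Up p ∧ a.Down (p + 1) := by
          rw [down_iff]
          rcases (show p = r + 1 ∨ p + 1 = r by omega) with rfl | rfl
          · have := Ha.2.2 (r + 1 + 1) (by omega) (by omega)
            tauto
          · have := Ha.2.2 p (by omega) (by omega)
            tauto
        have hh : a.height (p + 1) = a.height (r + 1) + 1 := by
          rcases (show p = r + 1 ∨ p + 1 = r by omega) with rfl | rfl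
          · exact hu1
          · exact hd1.symm
        have hbraid : ∀ v : U n, E q p (E q r (E q p v)) = E q p v := by
          intro v
          rcases (show p = r + 1 ∨ p + 1 = r by omega) with rfl | rfl
          · exact E_succ_E_E_succ q hp v
          · exact E_E_succ_E q Ha.1.2.lt v
        -- At height 0, `E q p` acts on `xi' q a` by `q`, so the braid-type relation gives `E q p (E
        -- q r ξ'_a) = ξ'_a`, which cancels against `μ_1 q ξ'_a`.
        rcases Nat.eq_zero_or_pos (a.height (r + 1)) with h0 | h0
        · have h1 := E_xi'_of_height_eq_one (q := q) hmax.1 hmax.2 (by omega)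
          have h2 := hbraid (xi' q a)
          have hq' : (q : ℂ) ≠ 0 := by exact_mod_cast hq
          rw [h1, map_smul, map_smul] at h2
          have h3 := smul_right_injective _ hq' h2
          rw [map_sub, map_smul, h1, h3, h0, smul_smul]
          simp [mu, cheb_zero, cheb_one, hq']
        -- Removing the maximum at `p + 1` as well gives `c` with a slope at `r + 1`, so `E q r`
        -- kills `xi' q c`. With `h = a.height (r + 1)`, the remaining terms are `(1 - μ_{h+1}(q -
        -- μ_h)) E q p ξ'_c = 0`.
        · obtain ⟨c, hc⟩ := exists_removal hmax.1 hmax.2 (by omega)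
          have Hc := isBoxAddition_succ.1 hc
          have hhc := hc.height_eq (p + 1) hp.le
          rw [if_pos rfl] at hhc
          simp only [down_iff] at Hc
          have h1 := ih _ (hm ▸ hc.size_lt.trans ha.size_lt) (b := c) (p := r)
            ((hb.of_isBoxAddition ha).of_isBoxAddition hc) Ha.1.2.lt (by grind) rfl
          have h2 := mu_succ_mul_sub (q := q) h0 (hne _ (by omega)) (hne _ (by omega))
          have h2' : ((mu q (a.height (r + 1) + 1) : ℂ) * (q - mu q (a.height (r + 1)))) = 1 := by
            exact_mod_cast h2
          rw [xi'_of_isBoxAddition hc, show c.height (p + 1) + 1 = a.height (r + 1) by omega]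
          simp only [map_sub, map_smul, hbraid, h1, E_E, smul_zero, sub_zero]
          rw [← sub_smul, smul_smul, h2', one_smul, sub_self]

/-! ### Orthogonality -/

theorem form_E_sub (p : ℕ) (m : ℝ) (v w : U n) :
    form q (E q p v - (m : ℂ) • v) w = form q v (E q p w) - m * form q v w := by
  rw [form_sub_left, form_smul_left, form_E]

/-- `E (E - μ) = (q - μ) E`, and `E ξ'_a = ξ'_b + μ ξ'_a` by the definition of `ξ'_b`. -/
theorem E_xi'_of_isBoxAddition {a b : HalfDiagram n} {p : ℕ} (h : IsBoxAddition (p + 1) a b) :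
    E q p (xi' q b) = ((q : ℂ) - mu q (a.height (p + 1) + 1)) •
      (xi' q b + (mu q (a.height (p + 1) + 1) : ℂ) • xi' q a) := by
  rw [xi'_of_isBoxAddition h, map_sub, map_smul, E_E]
  module

theorem form_xi'_of_ne (hq : q ≠ 0) {a b : HalfDiagram n} (ha : ChebNeZero q a)
    (hb : ChebNeZero q b) (hab : a ≠ b) : form q (xi' q a) (xi' q b) = 0 := by
  induction hm : a.size + b.size using Nat.strong_induction_on generalizing a b with
  | _ m ih =>
    -- `i` is the first step at which the paths differ; by symmetry `a` descends there and `b`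
    -- ascends.
    obtain ⟨i, hi, hlt⟩ : ∃ i, ¬ (a.Up i ↔ b.Up i) ∧ ∀ k < i, (a.Up k ↔ b.Up k) := by
      have h : ∃ i, ¬ (a.Up i ↔ b.Up i) := by
        by_contra! h
        exact hab (eq_of_up_iff h)
      classical
      exact ⟨Nat.find h, Nat.find_spec h, fun k hk => not_not.1 (Nat.find_min h hk)⟩
    have hin : i < n := by
      by_contra hn
      exact hi (iff_of_false (fun h => hn h.lt) fun h => hn h.lt)
    wlog hd : a.Down i generalizing a b
    · rw [← conj_form, this hb ha hab.symm (by omega) (by tauto) (fun k hk => (hlt k hk).symm)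
        (down_iff.2 ⟨hin, fun h => hi (iff_of_true
          ((a.up_or_down hin).resolve_right hd) h)⟩), map_zero]
    have hu : b.Up i := by
      by_contra h
      exact hi (iff_of_false hd.not_up h)
    obtain ⟨j, rfl⟩ : ∃ j, i = j + 1 := ⟨i - 1, by
      have := hd.height_succ
      have : i ≠ 0 := by rintro rfl; simp [height_zero] at this
      omega⟩
    -- If the common preceding step goes up, `a` has a maximum where `b` has a slope.
    -- Self-adjointness moves `E q j` onto `xi' q b`, which it kills.
    by_cases hj : a.Up j
    · have hslope := E_xi'_of_slope hq hb hin (iff_of_true ((hlt j (by omega)).1 hj) hu)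
      by_cases h1 : a.height (j + 1) = 1
      · have h2 := form_E q j (xi' q a) (xi' q b)
        rw [hslope, form_zero_right, E_xi'_of_height_eq_one hj hd h1, form_smul_left] at h2
        exact (mul_eq_zero.1 h2).resolve_left (by exact_mod_cast hq)
      · obtain ⟨c, hc⟩ := exists_removal hj hd (by have := hd.height_succ; omega)
        have hcb : c ≠ b := by
          rintro rfl
          exact (isBoxAddition_succ.1 hc).1.1.not_up ((hlt j (by omega)).1 hj)
        rw [xi'_of_isBoxAddition hc, form_E_sub, hslope, form_zero_right,
          ih _ (by have := hc.size_lt; omega) (ha.of_isBoxAddition hc) hb hcb rfl]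
        simp
    · have hdj := down_iff.2 ⟨by omega, hj⟩
      -- Otherwise both paths share an earlier maximum, of height at least 2 because `a` descends
      -- twice after it. Removing that box from both paths leaves their difference at step `j + 1`
      -- intact, so induction applies to `c`, `b` and to `c`, `d`.
      obtain ⟨p, hpj, hp1, hp2, hp3⟩ := hdj.exists_maximum
      have hp4 := hdj.height_succ
      have hp5 := hd.height_succ
      obtain ⟨c, hc⟩ := exists_removal hp1 hp2 (by omega)
      have hp1' := (hlt p (by omega)).1 hp1
      have hp2' : b.Down (p + 1) :=
        down_iff.2 ⟨hp2.lt, (hlt (p + 1) (by omega)).not.1 hp2.not_up⟩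
      have hh : a.height (p + 1) = b.height (p + 1) :=
        height_congr hp2.lt.le fun k hk => hlt k (by omega)
      obtain ⟨d, hdb⟩ := exists_removal hp1' hp2' (by omega)
      have e1 := hc.height_eq (p + 1) hp2.lt.le
      have e2 := hdb.height_eq (p + 1) hp2.lt.le
      have s1 := hc.size_lt
      have s2 := hdb.size_lt
      have Hc := isBoxAddition_succ.1 hc
      have Hd := isBoxAddition_succ.1 hdb
      have hcb : c ≠ b := by
        rintro rfl
        exact Hc.1.1.not_up hp1'
      have hcd : c ≠ d := by
        rintro rfl
        exact hi ((Hc.2.2 _ (by omega) (by omega)).trans (Hd.2.2 _ (by omega) (by omega)).symm)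
      have f1 := ih _ (by omega) (ha.of_isBoxAddition hc) hb hcb rfl
      have f2 := ih _ (by omega) (ha.of_isBoxAddition hc) (hb.of_isBoxAddition hdb) hcd rfl
      rw [xi'_of_isBoxAddition hc, form_E_sub, f1, E_xi'_of_isBoxAddition hdb, form_smul_right,
        form_add_right, form_smul_right, f1, f2]
      simp

/-! ### Norms as products over closing brackets -/

/-- The squared norm of `xi' q a` as a product over the closing brackets. -/
noncomputable def closingProduct (q : ℝ) (a : HalfDiagram n) : ℂ :=
  ∏ k ∈ (Finset.range n).filter a.Down, (cheb q (a.height k) : ℂ) / cheb q (a.height (k + 1))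

theorem closingProduct_of_isMinimal {a : HalfDiagram n} (h : a.IsMinimal) :
    closingProduct q a = (q : ℂ) ^ (Finset.univ.filter fun k => ¬ a.IsOpening k).card := by
  have : ∀ k ∈ (Finset.range n).filter a.Down,
      (cheb q (a.height k) : ℂ) / cheb q (a.height (k + 1)) = q := by
    intro k hk
    have hd := (Finset.mem_filter.1 hk).2
    have h1 := isMinimal_iff.1 h k hd
    have h2 := hd.height_succ
    rw [h1, show a.height (k + 1) = 0 by omega, cheb_zero, cheb_one]
    simp
  rw [closingProduct, Finset.prod_congr rfl this, Finset.prod_const]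
  congr 1
  rw [← Finset.card_map Fin.valEmbedding]
  congr 1
  ext k
  simp only [Finset.mem_filter, Finset.mem_range, Finset.mem_map, Finset.mem_univ, true_and,
    Fin.valEmbedding_apply]
  constructor
  · rintro ⟨hk, _, ho⟩
    exact ⟨⟨k, hk⟩, ho, rfl⟩
  · rintro ⟨x, hx, rfl⟩
    exact ⟨x.2, x.2, hx⟩

/-- With `h = a.height (p + 1)`, the box replaces a descent from `h + 1` to `h` by one from `h + 2`
to `h + 1` and leaves all other factors unchanged. -/
theorem closingProduct_of_isBoxAddition {a b : HalfDiagram n} {p : ℕ}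
    (h : IsBoxAddition (p + 1) a b) (h0 : cheb q (a.height (p + 1)) ≠ 0)
    (h1 : cheb q (a.height (p + 1) + 1) ≠ 0) : closingProduct q b =
      (q - mu q (a.height (p + 1) + 1)) * mu q (a.height (p + 1) + 1) * closingProduct q a := by
  obtain ⟨⟨d1, u1⟩, ⟨u2, d2⟩, hs⟩ := isBoxAddition_succ.1 h
  have split : ∀ c : HalfDiagram n, closingProduct q c =
      (if c.Down p then (cheb q (c.height p) : ℂ) / cheb q (c.height (p + 1)) else 1) *
      ((if c.Down (p + 1) then (cheb q (c.height (p + 1)) : ℂ) / cheb q (c.height (p + 1 + 1))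
          else 1) *
        ∏ k ∈ ((Finset.range n).erase p).erase (p + 1),
          if c.Down k then (cheb q (c.height k) : ℂ) / cheb q (c.height (k + 1)) else 1) := by
    intro c
    rw [Finset.mul_prod_erase _ (fun k => if c.Down k then
        (cheb q (c.height k) : ℂ) / cheb q (c.height (k + 1)) else 1) (by simpa using u1.lt),
      Finset.mul_prod_erase _ (fun k => if c.Down k then
        (cheb q (c.height k) : ℂ) / cheb q (c.height (k + 1)) else 1) (by simpa using d1.lt),
      closingProduct, Finset.prod_filter]
  have hcongr : ∀ k ∈ ((Finset.range n).erase p).erase (p + 1),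
      (if b.Down k then (cheb q (b.height k) : ℂ) / cheb q (b.height (k + 1)) else 1) =
      if a.Down k then (cheb q (a.height k) : ℂ) / cheb q (a.height (k + 1)) else 1 := by
    intro k hk
    simp only [Finset.mem_erase, Finset.mem_range] at hk
    have e1 := h.height_eq k (by omega)
    have e2 := h.height_eq (k + 1) (by omega)
    rw [if_neg (by omega), add_zero] at e1 e2
    have e3 : b.Down k ↔ a.Down k := by rw [down_iff, down_iff, hs k hk.2.1 hk.1]
    simp only [e1, e2, e3]
  rw [split a, split b, Finset.prod_congr rfl hcongr, if_pos d1, if_neg u1.not_down,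
    if_neg u2.not_down, if_pos d2]
  have e1 := h.height_eq (p + 1) u1.lt.le
  rw [if_pos rfl] at e1
  have e2 := d2.height_succ
  have e3 := d1.height_succ
  rw [show b.height (p + 1 + 1) = a.height (p + 1) + 1 by omega, e1, ← e3]
  generalize a.height (p + 1) = m at *
  have h2 := cheb_add_two q m
  simp only [mu, Nat.add_sub_cancel, h2]
  push_cast
  have h0' : (cheb q m : ℂ) ≠ 0 := by exact_mod_cast h0
  have h1' : (cheb q (m + 1) : ℂ) ≠ 0 := by exact_mod_cast h1
  field_simp

theorem form_xi'_self (hq : q ≠ 0) {a : HalfDiagram n} (ha : ChebNeZero q a) :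
    form q (xi' q a) (xi' q a) = closingProduct q a := by
  induction hm : a.size using Nat.strong_induction_on generalizing a with
  | _ m ih =>
    by_cases hmin : a.IsMinimal
    · rw [xi'_of_isMinimal hmin, form_xi_xi, gram_self, closingProduct_of_isMinimal hmin]
    · obtain ⟨p, c, hc⟩ := exists_isBoxAddition_of_not_isMinimal hmin
      have hc' := ha.of_isBoxAddition hc
      have hca : c ≠ a := by rintro rfl; exact hc.size_lt.ne rfl
      have f1 := form_xi'_of_ne hq hc' ha hca
      have f2 := ih _ (hm ▸ hc.size_lt) hc' rfl
      have Hc := isBoxAddition_succ.1 hc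
      have hh := hc.height_eq (p + 1) Hc.1.2.lt.le
      rw [if_pos rfl] at hh
      have hne := fun k => ha.ne (k := k) Hc.2.1.1 Hc.2.1.2
      rw [closingProduct_of_isBoxAddition hc (hne _ (by omega)) (hne _ (by omega)), ← f2]
      conv_lhs => rw [xi'_of_isBoxAddition hc, form_E_sub, ← xi'_of_isBoxAddition hc, f1,
        E_xi'_of_isBoxAddition hc, form_smul_right, form_add_right, form_smul_right, f1]
      simp
      ring

/-- A height strictly inside a descending run occurs once in the numerator and once in the
denominator. What survives above is the tops of the runs, and below their bottoms; a run ending at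
`n` is why `n` can count as a minimum. -/
theorem closingProduct_eq {a : HalfDiagram n} (ha : ChebNeZero q a) : closingProduct q a =
    (∏ i ∈ a.maxima, (cheb q (a.height i) : ℂ)) / ∏ j ∈ a.minima, (cheb q (a.height j) : ℂ) := by
  let D := (Finset.range n).filter a.Down
  let D' := D.map (addRightEmbedding 1)
  have hpos : ∀ k, a.Down k → k ≠ 0 := by
    rintro k hk rfl
    have := hk.height_succ
    simp [height_zero] at this
  have e1 : D.filter (fun k => ¬ a.Down (k - 1)) = a.maxima := by
    ext k
    simp only [D, maxima, Finset.mem_filter, Finset.mem_range, and_assoc, and_congr_right_iff]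
    intro hk
    constructor
    · rintro ⟨h1, h2⟩
      obtain ⟨s, rfl⟩ : ∃ s, k = s + 1 := ⟨k - 1, by have := hpos k h1; omega⟩
      exact isMaximum_succ.2 ⟨(a.up_or_down (by omega)).resolve_right h2, h1⟩
    · intro h
      obtain ⟨s, rfl⟩ : ∃ s, k = s + 1 := ⟨k - 1, by have := h.1; omega⟩
      exact ⟨(isMaximum_succ.1 h).2, (isMaximum_succ.1 h).1.not_down⟩
  have e2 : D'.filter (fun k => ¬ a.Down k) = a.minima := by
    ext k
    simp only [D', D, minima, Finset.mem_filter, Finset.mem_range, Finset.mem_map,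
      addRightEmbedding_apply]
    constructor
    · rintro ⟨⟨s, ⟨hs, hd⟩, rfl⟩, h⟩
      refine ⟨by omega, ?_⟩
      by_cases hn : s + 1 < n
      · exact .inl (isMinimum_succ.2 ⟨hd, (a.up_or_down hn).resolve_right h⟩)
      · obtain rfl : s + 1 = n := by omega
        exact .inr ⟨by omega, rfl, (down_iff_height_lt (by omega)).1 hd⟩
    · rintro ⟨hk, h | ⟨h1, rfl, h2⟩⟩
      · obtain ⟨s, rfl⟩ : ∃ s, k = s + 1 := ⟨k - 1, by have := h.1; omega⟩
        have := isMinimum_succ.1 h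
        exact ⟨⟨s, ⟨this.1.lt, this.1⟩, rfl⟩, this.2.not_down⟩
      · obtain ⟨s, rfl⟩ : ∃ s, k = s + 1 := ⟨k - 1, by omega⟩
        exact ⟨⟨s, ⟨by omega, (down_iff_height_lt (by omega)).2 h2⟩, rfl⟩,
          fun h => absurd h.lt (by omega)⟩
  have e3 : D'.filter (fun k => a.Down k) = D.filter (fun k => a.Down (k - 1)) := by
    ext k
    simp only [D', D, Finset.mem_filter, Finset.mem_range, Finset.mem_map,
      addRightEmbedding_apply]
    constructor
    · rintro ⟨⟨s, ⟨hs, hd⟩, rfl⟩, h⟩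
      exact ⟨⟨h.lt, h⟩, hd⟩
    · rintro ⟨⟨hk, h1⟩, h2⟩
      have := hpos k h1
      exact ⟨⟨k - 1, ⟨by omega, h2⟩, by omega⟩, h1⟩
  have h1 : ∏ k ∈ D, (cheb q (a.height k) : ℂ) =
      (∏ k ∈ D.filter (fun k => a.Down (k - 1)), (cheb q (a.height k) : ℂ)) *
        ∏ i ∈ a.maxima, (cheb q (a.height i) : ℂ) := by
    rw [← e1, Finset.prod_filter_mul_prod_filter_not]
  have h2 : ∏ k ∈ D, (cheb q (a.height (k + 1)) : ℂ) =
      (∏ k ∈ D.filter (fun k => a.Down (k - 1)), (cheb q (a.height k) : ℂ)) *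
        ∏ i ∈ a.minima, (cheb q (a.height i) : ℂ) := by
    rw [← e2, ← e3, Finset.prod_filter_mul_prod_filter_not, Finset.prod_map]
    rfl
  -- The cancelled heights lie strictly below the maximum that tops their run, so the hypothesis on
  -- `Δ` covers them.
  have h3 : ∏ k ∈ D.filter (fun k => a.Down (k - 1)), (cheb q (a.height k) : ℂ) ≠ 0 := by
    refine Finset.prod_ne_zero_iff.2 fun k hk => ?_
    simp only [D, Finset.mem_filter] at hk
    obtain ⟨p, -, hp1, hp2, hp3⟩ := hk.2.exists_maximum
    have h4 := hk.2.height_succ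
    rw [Nat.sub_add_cancel (Nat.one_le_iff_ne_zero.2 (hpos k hk.1.2))] at h4
    exact_mod_cast ha.ne hp1 hp2 (by omega)
  rw [closingProduct, Finset.prod_div_distrib, h1, h2, mul_div_mul_left _ _ h3]

end TemperleyLieb

theorem mainTheorem5 (n : ℕ) (q : ℝ) (hq : 0 < q) (a : TemperleyLieb.HalfDiagram n)
    (hΔ : ∀ i ∈ a.maxima, ∀ k, k < a.height i → TemperleyLieb.cheb q k ≠ 0) :
    TemperleyLieb.form q (TemperleyLieb.xi' q a) (TemperleyLieb.xi' q a) =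
      (∏ i ∈ a.maxima, (TemperleyLieb.cheb q (a.height i) : ℂ)) /
        ∏ j ∈ a.minima, (TemperleyLieb.cheb q (a.height j) : ℂ) := by
  rw [TemperleyLieb.form_xi'_self hq.ne' hΔ, TemperleyLieb.closingProduct_eq hΔ]
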